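/- Let $\delta>0$, let $(S,d)$ be a $\delta$-hyperbolic space, i.e. a geodesic metric space in which every side of every geodesic triangle is contained in the closed $\delta$-neighborhood of the union of the other two sides, and let $\Gamma$ be a group acting on $S$ by isometries. Assume that the action is acylindrical: for every $r>0$ there exist $R,N>0$ such that for all $x,x'\in S$ with $d(x,x')\ge R$, \[ \#\{g\in\Gamma \mid d(x,gx)\le r \text{ and } d(x',gx')\le r\}\le N . \] An element $g\in\Gamma$ is called loxodromic if its translation length $\tau(g)=\lim_{n\to\infty}\frac1n d(x,g^nx)$ (which does not depend on $x\in S$) is positive. It is called achiral if $g^m$ is conjugate to $g^{-m}$ in $\Gamma$ for some integer $m>0$, and chiral otherwise. For $g\in[\Gamma,\Gamma]$ let $\mathrm{cl}(g)$ be the least number of commutators in $\Gamma$ whose product is $g$, and $\mathrm{scl}(g)=\lim_{n\to\infty}\mathrm{cl}(g^n)/n$; for general $g\in\Gamma$ put $\mathrm{scl}(g)=\mathrm{scl}(g^m)/m$ if $g^m\in[\Gamma,\Gamma]$ for some integer $m>0$ (the value does not depend on $m$), and $\mathrm{scl}(g)=\infty$ if there is no such $m$. Then: \begin{enumerate} \item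 A loxodromic element $g\in\Gamma$ is achiral if and only if $\mathrm{scl}(g)=0$. \item There exists a constant $\Theta>0$ such that $\mathrm{scl}(g)\ge\Theta$ for every chiral loxodromic element $g\in\Gamma$. \end{enumerate} -/

import Mathlib

namespace SclGap

open Filter Topology
open scoped ENNReal

/-! ### Hyperbolic geodesic spaces -/

section Hyperbolic

variable {S : Type*} [MetricSpace S]

/-- `A` is (the image of) a geodesic from `x` to `y`. -/
def IsGeodesicSegment (A : Set S) (x y : S) : Prop :=
  ∃ c : ℝ → S, c 0 = x ∧ c (dist x y) = y ∧
    (∀ s ∈ Set.Icc 0 (dist x y), ∀ t ∈ Set.Icc 0 (dist x y), dist (c s) (c t) = |s - t|) ∧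
    A = c '' Set.Icc 0 (dist x y)

/-- `A` is contained in the closed `δ`-neighbourhood of `B`. For a nonempty compact `B`, such as
a union of geodesic segments, this is the condition `d(p, B) ≤ δ` for all `p ∈ A`. -/
def InNeighborhood (δ : ℝ) (A B : Set S) : Prop :=
  ∀ p ∈ A, ∃ q ∈ B, dist p q ≤ δ

variable (S) in
/-- `S` is a geodesic space all of whose geodesic triangles are `δ`-slim. -/
structure IsHyperbolicSpace (δ : ℝ) : Prop where
  exists_geodesic : ∀ x y : S, ∃ A : Set S, IsGeodesicSegment A x y
  slim : ∀ (x y z : S) (A B C : Set S), IsGeodesicSegment A x y → IsGeodesicSegment B y z →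
    IsGeodesicSegment C z x →
      InNeighborhood δ A (B ∪ C) ∧ InNeighborhood δ B (C ∪ A) ∧ InNeighborhood δ C (A ∪ B)

end Hyperbolic

/-! ### Acylindrical actions and loxodromic elements -/

section Action

variable {Γ S : Type*} [Group Γ] [MetricSpace S] [MulAction Γ S]

variable (Γ S) in
/-- The action of `Γ` on `S` is acylindrical. -/
def IsAcylindrical : Prop :=
  ∀ r : ℝ, 0 < r → ∃ (R : ℝ) (N : ℕ), 0 < R ∧ 0 < N ∧ ∀ x x' : S, R ≤ dist x x' →
    {g : Γ | dist x (g • x) ≤ r ∧ dist x' (g • x') ≤ r}.encard ≤ N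

/-- The translation length `lim_{n → ∞} d(x, gⁿ x) / n`, computed at the point `x`. For an
isometric action the limit exists and is independent of `x`, see `tendsto_translationLength`
and `translationLength_eq`. -/
noncomputable def translationLength (g : Γ) (x : S) : ℝ :=
  limUnder atTop (fun n : ℕ => dist x (g ^ n • x) / n)

theorem tendsto_translationLength [IsIsometricSMul Γ S] (g : Γ) (x : S) :
    Tendsto (fun n : ℕ => dist x (g ^ n • x) / n) atTop (𝓝 (translationLength g x)) := by
  have h : Subadditive (fun n : ℕ => dist x (g ^ n • x)) := by
    intro m n
    calc dist x (g ^ (m + n) • x)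
        ≤ dist x (g ^ m • x) + dist (g ^ m • x) (g ^ (m + n) • x) := dist_triangle _ _ _
      _ = dist x (g ^ m • x) + dist x (g ^ n • x) := by rw [pow_add, mul_smul, dist_smul]
  refine tendsto_nhds_limUnder ⟨_, h.tendsto_lim ⟨0, ?_⟩⟩
  rintro _ ⟨n, rfl⟩
  positivity

theorem translationLength_eq [IsIsometricSMul Γ S] (g : Γ) (x y : S) :
    translationLength g x = translationLength g y := by
  have key : Tendsto (fun n : ℕ => dist x (g ^ n • x) / n - dist y (g ^ n • y) / n) atTop
      (𝓝 0) := by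
    refine squeeze_zero_norm (a := fun n : ℕ => (2 * dist x y) / n) (fun n => ?_)
      (tendsto_const_div_atTop_nhds_zero_nat _)
    rw [← sub_div, norm_div, Real.norm_natCast]
    gcongr
    rw [Real.norm_eq_abs, abs_le]
    have h1 := dist_triangle4 x y (g ^ n • y) (g ^ n • x)
    have h2 := dist_triangle4 y x (g ^ n • x) (g ^ n • y)
    rw [dist_smul] at h1 h2
    rw [dist_comm y x] at h1 h2
    constructor <;> linarith
  have := tendsto_nhds_unique key
    ((tendsto_translationLength g x).sub (tendsto_translationLength g y))
  linarith

variable (S) in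
/-- `g` acts on `S` with positive translation length. -/
def IsLoxodromic (g : Γ) : Prop :=
  ∃ x : S, 0 < translationLength g x

end Action

/-! ### Achiral elements, word norms and stable commutator length -/

section Norms

variable {Γ : Type*} [Group Γ]

/-- Some positive power `a ^ m` is conjugate to `a ^ (-m)`. -/
def IsAchiral (a : Γ) : Prop :=
  ∃ m : ℕ, 0 < m ∧ IsConj (a ^ m) (a ^ (-(m : ℤ)))

/-- An element is chiral if it is not achiral. -/
def IsChiral (a : Γ) : Prop := ¬ IsAchiral a

/-- The word norm of a symmetric set `A`: the least number of elements of `A` whose product is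
`g`. Meaningful for `g` in the subgroup generated by `A`. -/
noncomputable def wordNorm (A : Set Γ) (g : Γ) : ℕ :=
  sInf {n : ℕ | ∃ l : List Γ, l.length = n ∧ (∀ a ∈ l, a ∈ A) ∧ l.prod = g}

/-- The limit of `ν_A(gⁿ) / n`, for `g` in the subgroup generated by the symmetric set `A`. It
exists by `tendsto_stableWordNorm`. -/
noncomputable def stableWordNorm (A : Set Γ) (g : Γ) : ℝ :=
  limUnder atTop (fun n : ℕ => (wordNorm A (g ^ n) : ℝ) / n)

open Classical in
/-- The stable norm of a symmetric set `A`, extended to all of `Γ`: if a positive power `g ^ m`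
lies in the subgroup generated by `A`, it is the stable norm of `g ^ m` divided by `m`
(independently of `m`, see `extStableWordNorm_eq`); otherwise it is `∞`. -/
noncomputable def extStableWordNorm (A : Set Γ) (g : Γ) : ℝ≥0∞ :=
  if h : ∃ m : ℕ, 0 < m ∧ g ^ m ∈ Subgroup.closure A then
    ENNReal.ofReal (stableWordNorm A (g ^ Nat.find h) / (Nat.find h : ℝ))
  else ⊤

/-- Stable commutator length: the extended stable norm of the set of all commutators. -/
noncomputable def scl (g : Γ) : ℝ≥0∞ :=
  extStableWordNorm (commutatorSet Γ) g

theorem exists_word {A : Set Γ} (hA : ∀ a ∈ A, a⁻¹ ∈ A) {g : Γ} (hg : g ∈ Subgroup.closure A) :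
    ∃ l : List Γ, l.length = wordNorm A g ∧ (∀ a ∈ l, a ∈ A) ∧ l.prod = g := by
  have hne : {n : ℕ | ∃ l : List Γ, l.length = n ∧ (∀ a ∈ l, a ∈ A) ∧ l.prod = g}.Nonempty := by
    rw [← Subgroup.mem_toSubmonoid, Subgroup.closure_toSubmonoid] at hg
    obtain ⟨l, hl, hp⟩ := Submonoid.exists_list_of_mem_closure hg
    refine ⟨l.length, l, rfl, fun a ha => ?_, hp⟩
    rcases hl a ha with h | h
    · exact h
    · simpa using hA _ h
  exact Nat.sInf_mem hne

theorem wordNorm_mul_le {A : Set Γ} (hA : ∀ a ∈ A, a⁻¹ ∈ A) {g h : Γ}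
    (hg : g ∈ Subgroup.closure A) (hh : h ∈ Subgroup.closure A) :
    wordNorm A (g * h) ≤ wordNorm A g + wordNorm A h := by
  obtain ⟨l, hl, hlA, hlp⟩ := exists_word hA hg
  obtain ⟨k, hk, hkA, hkp⟩ := exists_word hA hh
  refine Nat.sInf_le ⟨l ++ k, by simp [hl, hk], ?_, by simp [hlp, hkp]⟩
  intro a ha
  rcases List.mem_append.1 ha with h | h
  · exact hlA a h
  · exact hkA a h

theorem tendsto_stableWordNorm {A : Set Γ} (hA : ∀ a ∈ A, a⁻¹ ∈ A) {g : Γ}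
    (hg : g ∈ Subgroup.closure A) :
    Tendsto (fun n : ℕ => (wordNorm A (g ^ n) : ℝ) / n) atTop (𝓝 (stableWordNorm A g)) := by
  have h : Subadditive (fun n : ℕ => (wordNorm A (g ^ n) : ℝ)) := by
    intro m n
    simp only [pow_add]
    exact_mod_cast wordNorm_mul_le hA (pow_mem hg m) (pow_mem hg n)
  refine tendsto_nhds_limUnder ⟨_, h.tendsto_lim ⟨0, ?_⟩⟩
  rintro _ ⟨n, rfl⟩
  positivity

theorem stableWordNorm_pow {A : Set Γ} (hA : ∀ a ∈ A, a⁻¹ ∈ A) {g : Γ}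
    (hg : g ∈ Subgroup.closure A) {m : ℕ} (hm : 0 < m) :
    stableWordNorm A (g ^ m) = m * stableWordNorm A g := by
  have h1 := tendsto_stableWordNorm hA (pow_mem hg m)
  have h2 := ((tendsto_stableWordNorm hA hg).comp (tendsto_id.const_mul_atTop' hm)).const_mul
    (m : ℝ)
  refine tendsto_nhds_unique h1 (h2.congr fun n => ?_)
  have : (m : ℝ) ≠ 0 := by positivity
  rcases Nat.eq_zero_or_pos n with rfl | hn
  · simp
  · have : (n : ℝ) ≠ 0 := by positivity
    simp only [Function.comp, id, pow_mul, Nat.cast_mul]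
    field_simp

theorem extStableWordNorm_eq {A : Set Γ} (hA : ∀ a ∈ A, a⁻¹ ∈ A) {g : Γ} {m : ℕ} (hm : 0 < m)
    (hg : g ^ m ∈ Subgroup.closure A) :
    extStableWordNorm A g = ENNReal.ofReal (stableWordNorm A (g ^ m) / m) := by
  have aux : ∀ k : ℕ, 0 < k ∧ g ^ k ∈ Subgroup.closure A →
      stableWordNorm A (g ^ k) / (k : ℝ) = stableWordNorm A (g ^ m) / m := by
    rintro k ⟨hk, hgk⟩
    have e1 := stableWordNorm_pow hA hgk hm
    have e2 := stableWordNorm_pow hA hg hk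
    rw [← pow_mul] at e1 e2
    rw [mul_comm, e1] at e2
    have : (m : ℝ) ≠ 0 := by positivity
    have : (k : ℝ) ≠ 0 := by positivity
    field_simp
    linarith
  have h : ∃ m : ℕ, 0 < m ∧ g ^ m ∈ Subgroup.closure A := ⟨m, hm, hg⟩
  classical
  rw [extStableWordNorm, dif_pos h]
  exact congrArg ENNReal.ofReal (aux _ (Nat.find_spec h))

end Norms

end SclGap

namespace SclGap

open Filter Topology
open scoped ENNReal

/-! ### The four-point inequality -/

section FourPoint

variable {S : Type*} [MetricSpace S]

/-! If `h` conjugates `g ^ m` to its inverse, then `g ^ (2 * m * k)` is the commutator of `g ^ (m *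
k)` and `h`, so achiral elements have `scl = 0`. The converse follows from the gap, which comes from
quasi-morphisms of Brooks type with uniform defect.

Put `w = g ^ N` and take a base point `x₀` near an axis of `g`. The discounted distance `routeDist`
lets one traverse a translate of the pair `(x₀, w • x₀)`, in that direction only, for `Δ` less than
its length. It is `Γ`-invariant but not symmetric. Since near-optimal routes are quasi-geodesics,
Morse stability makes it additive along geodesics up to a constant depending only on `κ` and `Δ`
(`exists_routeDist_add_le`). Antisymmetrizing it gives a quasi-morphism whose defect does not depend
on `g` (`abs_routeDist_sub_le`).

Going from `x₀` to `w ^ n • x₀` earns `n` discounts. On the way back a useful discount would require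
a translate of `w` running along the axis in the opposite direction. Then the elements `γ * g ^ i *
γ⁻¹ * g ^ i` barely move two distant points (`dist_smul_le_of_reversed`), by acylindricity two of
them coincide, and `g` is achiral (`isAchiral_of_reversed`). So for chiral `g` the quasi-morphism
grows linearly on powers of `w`, which bounds `scl` from below (`abs_le_wordNorm`, `ofReal_le_scl`).

Uniformity in `g` rests on `exists_translationLength_ge`, which lets one exponent `N` serve all
loxodromic elements, and on `exists_axis_point`, whose error depends on `κ` alone. -/

variable (S) in
/-- The four-point form of hyperbolicity. -/
def FourPoint (κ : ℝ) : Prop :=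
  ∀ x y z t : S, dist x y + dist z t ≤ max (dist x z + dist y t) (dist x t + dist y z) + κ

variable (S) in
/-- Any two points are joined by a parametrized geodesic. -/
def HasGeodesics : Prop :=
  ∀ x y : S, ∃ c : ℝ → S, c 0 = x ∧ c (dist x y) = y ∧
    ∀ s ∈ Set.Icc 0 (dist x y), ∀ t ∈ Set.Icc 0 (dist x y), dist (c s) (c t) = |s - t|

/-- Twice the Gromov product of `x` and `y` based at `p`. -/
def excess (x y p : S) : ℝ := dist x p + dist p y - dist x y

theorem excess_comm (x y p : S) : excess x y p = excess y x p := by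
  unfold excess
  rw [dist_comm x y, dist_comm x p, dist_comm p y]
  ring

theorem excess_le_two_mul_dist_add (x y p q : S) :
    excess x y p ≤ excess x y q + 2 * dist p q := by
  have h1 := dist_triangle x q p
  have h2 := dist_triangle p q y
  rw [dist_comm q p] at h1
  unfold excess
  linarith

theorem IsHyperbolicSpace.hasGeodesics {δ : ℝ} (h : IsHyperbolicSpace S δ) : HasGeodesics S := by
  intro x y
  obtain ⟨A, c, h0, h1, hc, -⟩ := h.exists_geodesic x y
  exact ⟨c, h0, h1, hc⟩

theorem IsGeodesicSegment.excess_eq_zero {A : Set S} {x y q : S} (h : IsGeodesicSegment A x y)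
    (hq : q ∈ A) : excess x y q = 0 := by
  obtain ⟨c, h0, h1, hc, rfl⟩ := h
  obtain ⟨t, ht, rfl⟩ := hq
  have e1 := hc 0 ⟨le_rfl, dist_nonneg⟩ t ht
  have e2 := hc t ht (dist x y) ⟨dist_nonneg, le_rfl⟩
  rw [h0, zero_sub, abs_neg, abs_of_nonneg ht.1] at e1
  rw [h1, abs_sub_comm, abs_of_nonneg (sub_nonneg.2 ht.2)] at e2
  unfold excess
  linarith

theorem IsGeodesicSegment.left_mem {A : Set S} {x y : S} (h : IsGeodesicSegment A x y) :
    x ∈ A := by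
  obtain ⟨c, h0, h1, hc, rfl⟩ := h
  exact ⟨0, ⟨le_rfl, dist_nonneg⟩, h0⟩

theorem IsGeodesicSegment.right_mem {A : Set S} {x y : S} (h : IsGeodesicSegment A x y) :
    y ∈ A := by
  obtain ⟨c, h0, h1, hc, rfl⟩ := h
  exact ⟨dist x y, ⟨dist_nonneg, le_rfl⟩, h1⟩

/-- A geodesic contains a point whose distance to `p` is at most the Gromov product at `p`, up to
a multiple of `δ`. -/
theorem IsHyperbolicSpace.exists_near {δ : ℝ} (hδ : 0 < δ) (h : IsHyperbolicSpace S δ)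
    {A : Set S} {x y : S} (hA : IsGeodesicSegment A x y) (p : S) :
    ∃ q ∈ A, 2 * dist p q ≤ excess x y p + 8 * δ := by
  obtain ⟨B, hB⟩ := h.exists_geodesic y p
  obtain ⟨C, hC⟩ := h.exists_geodesic p x
  have hslim := (h.slim x y p A B C hA hB hC).1
  obtain ⟨c, h0, h1, hc, hAc⟩ := id hA
  set ℓ := dist x y with hℓ
  have hℓ0 : 0 ≤ ℓ := dist_nonneg
  -- Parameters at which the side is close to `[p, x]`. Just beyond the supremum the side must be
  -- close to `[y, p]`, so a parameter near the supremum is close to both; no continuity argument is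
  -- needed.
  set T : Set ℝ := {t | t ∈ Set.Icc 0 ℓ ∧ ∃ u ∈ C, dist (c t) u ≤ δ} with hT
  have h0T : (0 : ℝ) ∈ T := ⟨⟨le_rfl, hℓ0⟩, x, hC.right_mem, by rw [h0, dist_self]; exact hδ.le⟩
  have hbdd : BddAbove T := ⟨ℓ, fun t ht => ht.1.2⟩
  obtain ⟨t, htT, htlt⟩ := exists_lt_of_lt_csSup ⟨0, h0T⟩ (sub_lt_self (sSup T) hδ)
  obtain ⟨ht, u, hu, htu⟩ := htT
  have htle : t ≤ sSup T := le_csSup hbdd ⟨ht, u, hu, htu⟩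
  have hsup : sSup T ≤ ℓ := csSup_le ⟨0, h0T⟩ fun t ht => ht.1.2
  obtain ⟨t', ht', htt', v, hv, htv⟩ : ∃ t' ∈ Set.Icc 0 ℓ, |t - t'| ≤ 2 * δ ∧
      ∃ v ∈ B, dist (c t') v ≤ δ := by
    by_cases hcase : sSup T + δ ≤ ℓ
    · have hmem : sSup T + δ ∈ Set.Icc 0 ℓ := ⟨by linarith [ht.1], hcase⟩
      refine ⟨sSup T + δ, hmem, by rw [abs_le]; constructor <;> linarith, ?_⟩
      obtain ⟨v, hv, hd⟩ := hslim (c (sSup T + δ)) (by rw [hAc]; exact ⟨_, hmem, rfl⟩)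
      rcases hv with hv | hv
      · exact ⟨v, hv, hd⟩
      · have := le_csSup hbdd (show sSup T + δ ∈ T from ⟨hmem, v, hv, hd⟩)
        linarith
    · refine ⟨ℓ, ⟨hℓ0, le_rfl⟩, by rw [abs_le]; constructor <;> linarith, y, hB.left_mem, ?_⟩
      rw [h1, dist_self]; exact hδ.le
  have hqA : c t ∈ A := by rw [hAc]; exact ⟨t, ht, rfl⟩
  refine ⟨c t, hqA, ?_⟩
  have e1 := hA.excess_eq_zero hqA
  have e2 := hC.excess_eq_zero hu
  have e3 := hB.excess_eq_zero hv
  have e4 := hc t ht t' ht'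
  unfold excess at *
  have k1 := dist_triangle p u (c t)
  have k2 := dist_triangle x u (c t)
  have k3 := dist_triangle4 p v (c t') (c t)
  have k4 := dist_triangle4 y v (c t') (c t)
  rw [dist_comm (c t) u] at htu
  rw [dist_comm (c t') v] at htv
  rw [dist_comm (c t') (c t)] at k3 k4
  rw [dist_comm u x, dist_comm p x] at e2
  rw [dist_comm y p, dist_comm v p] at e3
  rw [dist_comm y (c t)] at k4
  linarith

theorem IsHyperbolicSpace.fourPoint {δ : ℝ} (hδ : 0 < δ) (h : IsHyperbolicSpace S δ) :
    FourPoint S (10 * δ) := by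
  intro x z p y
  obtain ⟨A, hA⟩ := h.exists_geodesic x z
  obtain ⟨B, hB⟩ := h.exists_geodesic z y
  obtain ⟨C, hC⟩ := h.exists_geodesic y x
  obtain ⟨q, hq, hpq⟩ := h.exists_near hδ hA p
  obtain ⟨q', hq', hqq'⟩ := (h.slim x z y A B C hA hB hC).1 q hq
  have k := dist_triangle p q q'
  unfold excess at hpq
  rcases hq' with hq' | hq'
  · have e := hB.excess_eq_zero hq'
    have e' := excess_le_two_mul_dist_add z y p q'
    unfold excess at e e'
    refine le_trans ?_ (add_le_add_left (le_max_left _ _) _)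
    rw [dist_comm z p] at *
    linarith
  · have e := hC.excess_eq_zero hq'
    have e' := excess_le_two_mul_dist_add y x p q'
    unfold excess at e e'
    refine le_trans ?_ (add_le_add_left (le_max_right _ _) _)
    rw [dist_comm z p, dist_comm y p, dist_comm y x, dist_comm p x] at *
    linarith

variable {κ : ℝ}

theorem FourPoint.min_excess_le (h : FourPoint S κ) (x y z p : S) :
    min (excess x y p) (excess y z p) ≤ excess x z p + κ := by
  have := h x z p y
  unfold excess
  rcases le_total (dist x p + dist z y) (dist x y + dist z p) with hm | hm
  · rw [max_eq_right hm] at this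
    refine (min_le_left _ _).trans ?_
    rw [dist_comm z p] at this
    linarith
  · rw [max_eq_left hm] at this
    refine (min_le_right _ _).trans ?_
    rw [dist_comm y p, dist_comm y z]
    linarith

/-- Every triangle has a centre, almost on all three sides. -/
theorem FourPoint.exists_center (h : FourPoint S κ) (hκ : 0 ≤ κ) (hg : HasGeodesics S)
    (x y z : S) :
    ∃ p, excess x y p ≤ κ ∧ excess y z p ≤ κ ∧ excess x z p ≤ κ := by
  obtain ⟨c, h0, h1, hc⟩ := hg x y
  -- The Gromov product of `y` and `z` at `x`: at this parameter the two terms of the maximum in the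
  -- four-point inequality agree.
  set X := (dist x y + dist x z - dist y z) / 2 with hX
  have hX0 : 0 ≤ X := by
    have := dist_triangle y x z
    rw [dist_comm y x] at this
    linarith
  have hXle : X ≤ dist x y := by
    have := dist_triangle x y z
    linarith
  have e1 := hc 0 ⟨le_rfl, dist_nonneg⟩ X ⟨hX0, hXle⟩
  have e2 := hc X ⟨hX0, hXle⟩ (dist x y) ⟨dist_nonneg, le_rfl⟩
  rw [h0, zero_sub, abs_neg, abs_of_nonneg hX0] at e1
  rw [h1, abs_sub_comm, abs_of_nonneg (sub_nonneg.2 hXle)] at e2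
  have h4 := h x y (c X) z
  rw [max_eq_left (by rw [dist_comm y (c X), e1, e2]; linarith)] at h4
  refine ⟨c X, ?_, ?_, ?_⟩ <;> unfold excess
  · linarith
  · rw [dist_comm y (c X)]; linarith
  · linarith

end FourPoint

/-! ### Displacement of the powers of an isometry -/

section Displacement

variable {Γ S : Type*} [Group Γ] [MetricSpace S] [MulAction Γ S] [IsIsometricSMul Γ S]

theorem dist_pow_smul (g : Γ) (x : S) {i j : ℕ} (h : i ≤ j) :
    dist (g ^ i • x) (g ^ j • x) = dist x (g ^ (j - i) • x) := by
  obtain ⟨k, rfl⟩ := Nat.exists_eq_add_of_le h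
  rw [pow_add, mul_smul, dist_smul, Nat.add_sub_cancel_left]

theorem dist_pow_smul_le (g : Γ) (x : S) (n : ℕ) :
    dist x (g ^ n • x) ≤ n * dist x (g • x) := by
  induction n with
  | zero => simp
  | succ n ih =>
    have h := dist_triangle x (g ^ n • x) (g ^ (n + 1) • x)
    rw [dist_pow_smul g x (show n ≤ n + 1 by omega), Nat.add_sub_cancel_left, pow_one] at h
    push_cast
    linarith

theorem translationLength_pow (g : Γ) (x : S) (k : ℕ) :
    translationLength (g ^ k) x = k * translationLength g x := by
  rcases Nat.eq_zero_or_pos k with rfl | hk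
  · have h := tendsto_translationLength (1 : Γ) x
    simp only [one_pow, one_smul, dist_self, zero_div] at h
    simpa using (tendsto_nhds_unique h tendsto_const_nhds)
  have h1 := tendsto_translationLength (g ^ k) x
  have h2 := ((tendsto_translationLength g x).comp (tendsto_id.const_mul_atTop' hk)).const_mul
    (k : ℝ)
  refine tendsto_nhds_unique h1 (h2.congr fun n => ?_)
  have : (k : ℝ) ≠ 0 := by positivity
  rcases Nat.eq_zero_or_pos n with rfl | hn
  · simp
  · have : (n : ℝ) ≠ 0 := by positivity
    simp only [Function.comp, id, pow_mul, Nat.cast_mul]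
    field_simp

theorem translationLength_le_dist (g : Γ) (x : S) : translationLength g x ≤ dist x (g • x) := by
  refine le_of_tendsto (tendsto_translationLength g x) ?_
  filter_upwards [eventually_gt_atTop 0] with n hn
  have : (0 : ℝ) < n := by exact_mod_cast hn
  rw [div_le_iff₀ this, mul_comm]
  exact dist_pow_smul_le g x n

theorem mul_translationLength_le_dist (g : Γ) (x : S) (n : ℕ) :
    n * translationLength g x ≤ dist x (g ^ n • x) := by
  rw [← translationLength_pow]
  exact translationLength_le_dist _ _

theorem translationLength_nonneg (g : Γ) (x : S) : 0 ≤ translationLength g x := by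
  refine ge_of_tendsto' (tendsto_translationLength g x) fun n => ?_
  positivity

theorem translationLength_pos {g : Γ} (hg : IsLoxodromic S g) (x : S) :
    0 < translationLength g x := by
  obtain ⟨y, hy⟩ := hg
  rwa [translationLength_eq g x y]

/-- A nonnegative sequence growing linearly at rate `τ` has a step at which both neighbours exceed
the middle term by at most about `τ`. -/
theorem exists_neighbors_le {a : ℕ → ℝ} {τ ε : ℝ} (ha : ∀ n, 0 ≤ a n) (hτ : 0 ≤ τ) (hε : 0 < ε)
    (hlim : Tendsto (fun n : ℕ => a n / n) atTop (𝓝 τ)) :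
    ∃ n, a n ≤ a (n + 1) + τ + ε ∧ a (n + 2) ≤ a (n + 1) + τ + ε := by
  by_contra! hcon
  -- By `hcon`, one increment above `τ + ε` forces all later ones to exceed it, contradicting the
  -- growth rate. If there is none, every step goes down by more than `τ + ε`, contradicting
  -- nonnegativity.
  by_cases hup : ∃ n, a n + τ + ε < a (n + 1)
  · obtain ⟨n, hn⟩ := hup
    have hstep : ∀ k, a (n + k) + τ + ε < a (n + k + 1) := by
      intro k
      induction k with
      | zero => exact hn
      | succ k ih => exact hcon (n + k) (by linarith)
    have hgrow : ∀ k : ℕ, k * (τ + ε) ≤ a (n + k) := by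
      intro k
      induction k with
      | zero => simpa using ha n
      | succ k ih =>
        have := hstep k
        push_cast
        rw [← add_assoc]
        linarith
    have hev : ∀ᶠ m : ℕ in atTop, a m / m < τ + ε / 2 :=
      hlim.eventually_lt_const (by linarith)
    have hbig : ∀ᶠ m : ℕ in atTop, (n * (τ + ε)) / (ε / 2) ≤ (m : ℝ) :=
      tendsto_natCast_atTop_atTop.eventually_ge_atTop _
    obtain ⟨m, hm1, hm2, hm3, hm4⟩ :=
      (hev.and (hbig.and ((eventually_ge_atTop n).and (eventually_gt_atTop 0)))).exists
    have hm0 : (0 : ℝ) < m := by exact_mod_cast hm4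
    obtain ⟨k, rfl⟩ := Nat.exists_eq_add_of_le hm3
    have h1 := hgrow k
    rw [div_lt_iff₀ hm0] at hm1
    rw [div_le_iff₀ (by linarith)] at hm2
    push_cast at *
    nlinarith
  · push Not at hup
    have hdown : ∀ n, a (n + 1) + τ + ε < a n := by
      intro n
      by_contra! hn
      linarith [hcon n hn, hup (n + 1)]
    have hdec : ∀ n : ℕ, a n ≤ a 0 - n * ε := by
      intro n
      induction n with
      | zero => simp
      | succ n ih =>
        have := hdown n
        push_cast
        linarith
    obtain ⟨n, hn⟩ := exists_nat_gt (a 0 / ε)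
    rw [div_lt_iff₀ hε] at hn
    linarith [hdec n, ha n]

/-- A sequence bounded below has a term that almost dominates a window of preceding terms. -/
theorem exists_window_le {b : ℕ → ℝ} {ε : ℝ} (hb : ∀ n, 0 ≤ b n) (hε : 0 < ε) (K : ℕ) :
    ∃ n, K ≤ n ∧ ∀ m, m ≤ n → n ≤ m + K → b m ≤ b n + ε := by
  by_contra! hcon
  set C := ∑ m ∈ Finset.range K, b m with hC
  have hC0 : ∀ m, m < K → b m ≤ C := fun m hm =>
    Finset.single_le_sum (fun i _ => hb i) (Finset.mem_range.2 hm)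
  have hall : ∀ n, b n ≤ C := by
    intro n
    induction n using Nat.strong_induction_on with
    | _ n ih =>
      rcases lt_or_ge n K with h | h
      · exact hC0 n h
      · obtain ⟨m, hm, hm', hlt⟩ := hcon n h
        rcases hm.lt_or_eq with hm | rfl
        · linarith [ih m hm]
        · linarith
  have hdec : ∀ k n : ℕ, k * K ≤ n → b n ≤ C - k * ε := by
    intro k
    induction k with
    | zero => intro n _; simpa using hall n
    | succ k ih =>
      intro n hn
      rw [Nat.succ_mul] at hn
      obtain ⟨m, hm, hm', hlt⟩ := hcon n (by omega)
      have := ih m (by omega)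
      push_cast
      linarith
  obtain ⟨k, hk⟩ := exists_nat_gt (C / ε)
  rw [div_lt_iff₀ hε] at hk
  linarith [hdec k _ le_rfl, hb (k * K)]

variable {κ : ℝ}

/-- Compare `x`, `g • x`, `g ^ 2 • x` with a distant orbit point `g ^ (n + 2) • x`, with `n` chosen
so that the displacements of `g ^ n` and `g ^ (n + 2)` do not much exceed that of `g ^ (n + 1)`. -/
theorem FourPoint.dist_sq_smul_le (h : FourPoint S κ) (hκ : 0 < κ) (g : Γ) (x : S) :
    dist x (g ^ 2 • x) ≤ dist x (g • x) + translationLength g x + 2 * κ := by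
  obtain ⟨n, h1, h2⟩ := exists_neighbors_le (a := fun n => dist x (g ^ n • x))
    (fun _ => dist_nonneg) (translationLength_nonneg g x) hκ (tendsto_translationLength g x)
  have h4 := h x (g ^ 2 • x) (g ^ 1 • x) (g ^ (n + 2) • x)
  rw [dist_pow_smul g x (show 1 ≤ n + 2 by omega), dist_pow_smul g x (show 2 ≤ n + 2 by omega),
    dist_comm (g ^ 2 • x) (g ^ 1 • x), dist_pow_smul g x (show 1 ≤ 2 by omega),
    show n + 2 - 1 = n + 1 by omega, show n + 2 - 2 = n by omega, show 2 - 1 = 1 by omega,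
    pow_one] at h4
  rcases le_max_iff.1 (sub_le_iff_le_add.2 h4) with h5 | h5 <;> linarith

/-- Some point is moved by `g` by little more than the translation length. -/
theorem FourPoint.exists_dist_smul_le (h : FourPoint S κ) (hκ : 0 < κ) (hg : HasGeodesics S)
    (g : Γ) (x : S) : ∃ q : S, dist q (g • q) ≤ translationLength g q + 4 * κ := by
  set τ := translationLength g x with hτ
  have hτ0 : 0 ≤ τ := translationLength_nonneg g x
  have hτ1 : τ ≤ dist x (g • x) := translationLength_le_dist g x
  have h2 := h.dist_sq_smul_le hκ g x
  obtain ⟨c, h0, h1, hc⟩ := hg x (g • x)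
  set a := dist x (g • x) with ha
  -- The excess `a - τ` is spent going from `x` to the axis and back, so the axis is met about half
  -- of it along `[x, g • x]`.
  set s := (a - τ) / 2 with hs
  have hs0 : 0 ≤ s := by linarith
  have hsa : s ≤ a := by linarith
  have e1 := hc 0 ⟨le_rfl, dist_nonneg⟩ s ⟨hs0, hsa⟩
  have e2 := hc s ⟨hs0, hsa⟩ a ⟨dist_nonneg, le_rfl⟩
  rw [h0, zero_sub, abs_neg, abs_of_nonneg hs0] at e1
  rw [h1, abs_sub_comm, abs_of_nonneg (sub_nonneg.2 hsa)] at e2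
  refine ⟨c s, ?_⟩
  rw [translationLength_eq g (c s) x, ← hτ]
  have e3 : dist (g • x) (g • c s) = s := by rw [dist_smul, e1]
  have e4 : dist (g • c s) (g ^ 2 • x) = a - s := by rw [pow_two, mul_smul, dist_smul, e2]
  have e5 : dist (g • x) (g ^ 2 • x) = a := by rw [pow_two, mul_smul, dist_smul]
  have k1 := h x (g • c s) (g • x) (g ^ 2 • x)
  rw [e4, e5, ← ha, dist_comm (g • c s) (g • x), e3] at k1
  have k2 := h (c s) (g • c s) x (g • x)
  rw [e2, ← ha, dist_comm (c s) x, e1, dist_comm (g • c s) (g • x), e3,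
    dist_comm (g • c s) x] at k2
  have k3 : dist x (g • c s) ≤ a - s + 3 * κ := by
    rcases le_max_iff.1 (sub_le_iff_le_add.2 k1) with h5 | h5 <;> linarith
  rcases le_max_iff.1 (sub_le_iff_le_add.2 k2) with h5 | h5 <;> linarith

/-- If `g ^ K` moves `x` by little more than its translation length, then so do the lower powers
of `g`. -/
theorem FourPoint.dist_pow_smul_le_of_le (h : FourPoint S κ) (hκ : 0 < κ) {g : Γ} {x : S} {K : ℕ}
    (hK : 2 * κ < K * translationLength g x)
    (hx : dist x (g ^ K • x) ≤ K * translationLength g x + 4 * κ) {j : ℕ} (hj : j ≤ K) :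
    dist x (g ^ j • x) ≤ j * translationLength g x + 8 * κ := by
  set τ := translationLength g x with hτ
  have hτ0 : 0 ≤ τ := translationLength_nonneg g x
  obtain ⟨n, hKn, hn⟩ := exists_window_le (b := fun n => dist x (g ^ n • x) - n * τ)
    (fun n => sub_nonneg.2 (mul_translationLength_le_dist g x n)) hκ K
  have key : ∀ i ≤ K, dist x (g ^ (K - i) • x) ≤ (K - i) * τ + 6 * κ ∨
      dist x (g ^ (K - i) • x) ≤ dist x (g ^ i • x) - K * τ + 2 * κ := by
    intro i hi
    have h4 := h x (g ^ n • x) (g ^ i • x) (g ^ K • x)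
    rw [dist_pow_smul g x hi, dist_comm (g ^ n • x) (g ^ K • x), dist_pow_smul g x hKn,
      dist_comm (g ^ n • x) (g ^ i • x), dist_pow_smul g x (hi.trans hKn)] at h4
    have w1 := hn (n - i) (by omega) (by omega)
    have w2 := hn (n - K) (by omega) (by omega)
    rw [Nat.cast_sub (hi.trans hKn)] at w1
    rw [Nat.cast_sub hKn] at w2
    rcases le_max_iff.1 (sub_le_iff_le_add.2 h4) with h5 | h5
    · right; linarith
    · left; linarith
  -- Both exponents `j` and `K - j` are needed: the second alternative cannot hold for both, since
  -- adding the two would give `K * τ ≤ 2 * κ`.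
  have k1 := key (K - j) (Nat.sub_le _ _)
  have k2 := key j hj
  rw [Nat.sub_sub_self hj, Nat.cast_sub hj] at k1
  have hjK : (j : ℝ) ≤ K := by exact_mod_cast hj
  have hj0 : 0 ≤ (j : ℝ) * τ := by positivity
  have hjK' : (j : ℝ) * τ ≤ K * τ := mul_le_mul_of_nonneg_right hjK hτ0
  rcases k1 with k1 | k1
  · linarith
  · rcases k2 with k2 | k2 <;> linarith

theorem FourPoint.exists_axis_point (h : FourPoint S κ) (hκ : 0 < κ) (hgeo : HasGeodesics S)
    {g : Γ} {τ : ℝ} (hτ : ∀ x : S, translationLength g x = τ) (x : S) {K : ℕ}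
    (hK : 2 * κ < K * τ) :
    ∃ q : S, ∀ j ≤ K, dist q (g ^ j • q) ≤ j * τ + 8 * κ := by
  obtain ⟨q, hq⟩ := h.exists_dist_smul_le hκ hgeo (g ^ K) x
  rw [translationLength_pow] at hq
  refine ⟨q, fun j hj => ?_⟩
  rw [← hτ q] at hK ⊢
  exact h.dist_pow_smul_le_of_le hκ hK hq hj

theorem pow_injective_of_isLoxodromic {g : Γ} (hg : IsLoxodromic S g) :
    Function.Injective (fun n : ℕ => g ^ n) := by
  obtain ⟨x, hx⟩ := hg
  have key : ∀ i j : ℕ, i ≤ j → g ^ i = g ^ j → i = j := by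
    intro i j hij he
    have h1 := dist_pow_smul g x hij
    rw [he, dist_self] at h1
    have h2 := mul_translationLength_le_dist g x (j - i)
    rw [← h1] at h2
    by_contra hne
    have : (0 : ℝ) < ((j - i : ℕ) : ℝ) := by exact_mod_cast (by omega : 0 < j - i)
    nlinarith
  intro i j he
  rcases le_total i j with hij | hij
  · exact key i j hij he
  · exact (key j i hij he.symm).symm

/-- Among `N + 1` terms lying in a set of at most `N` elements, two coincide. -/
theorem exists_eq_of_encard_le {α : Type*} {A : Set α} {N : ℕ} (hA : A.encard ≤ N)
    (u : ℕ → α) (hu : ∀ i ≤ N, u i ∈ A) : ∃ i j, i < j ∧ j ≤ N ∧ u i = u j := by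
  by_contra! hcon
  have hinj : Set.InjOn u (Set.Iic N) := by
    intro i hi j hj he
    rcases lt_trichotomy i j with h | h | h
    · exact absurd he (hcon i j h hj)
    · exact h
    · exact absurd he.symm (hcon j i h hi)
  have h1 : (u '' Set.Iic N).encard ≤ N :=
    (Set.encard_le_encard (by rintro _ ⟨i, hi, rfl⟩; exact hu i hi)).trans hA
  rw [hinj.encard_image] at h1
  have h2 : (Set.Iic N).encard = (N + 1 : ℕ) := by
    rw [← Finset.coe_Iic, Set.encard_coe_eq_coe_finsetCard, Nat.card_Iic]
  rw [h2] at h1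
  have : N + 1 ≤ N := by exact_mod_cast h1
  omega

/-- Translation lengths of loxodromic elements of an acylindrical action are bounded away from
zero. -/
theorem IsAcylindrical.exists_translationLength_ge (hΓ : IsAcylindrical Γ S)
    (h : FourPoint S κ) (hκ : 0 < κ) (hgeo : HasGeodesics S) :
    ∃ τ₀ : ℝ, 0 < τ₀ ∧ ∀ g : Γ, IsLoxodromic S g → ∀ x : S, τ₀ ≤ translationLength g x := by
  obtain ⟨R, N, hR, hN, hRN⟩ := hΓ (9 * κ) (by positivity)
  have hN' : (0 : ℝ) < N := by exact_mod_cast hN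
  -- Below this value the powers `g ^ i`, `i ≤ N`, drift by less than `κ` beyond the axis error `8 *
  -- κ`; this is why acylindricity was invoked at `9 * κ`.
  refine ⟨κ / N, by positivity, fun g hg x => ?_⟩
  by_contra! hlt
  have hpos := translationLength_pos hg x
  set τ := translationLength g x with hτ
  have hτ' : ∀ y : S, translationLength g y = τ := fun y => translationLength_eq g y x
  rw [lt_div_iff₀ hN'] at hlt
  obtain ⟨K₀, hK₀⟩ := exists_nat_gt ((R + 2 * κ) / τ)
  rw [div_lt_iff₀ hpos] at hK₀
  have hNτ : (0 : ℝ) ≤ N * τ := by positivity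
  have hKN : 2 * κ < ((K₀ + N : ℕ) : ℝ) * τ := by push_cast; linarith
  obtain ⟨q, hq⟩ := h.exists_axis_point hκ hgeo hτ' x hKN
  have hsmall : ∀ i ≤ N, dist q (g ^ i • q) ≤ 9 * κ := by
    intro i hi
    have h1 := hq i (by omega)
    have h2 : (i : ℝ) * τ ≤ N * τ := by gcongr
    linarith
  have hfar : R ≤ dist q (g ^ (K₀ + N) • q) := by
    have := mul_translationLength_le_dist g q (K₀ + N)
    rw [hτ'] at this
    push_cast at this
    linarith
  obtain ⟨i, j, hij, -, he⟩ := exists_eq_of_encard_le (hRN _ _ hfar) (fun i => g ^ i)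
    (fun i hi => ⟨hsmall i hi, by
      rw [← mul_smul, ← pow_add, dist_pow_smul g q (Nat.le_add_left _ _), Nat.add_sub_cancel]
      exact hsmall i hi⟩)
  exact hij.ne (pow_injective_of_isLoxodromic hg he)

end Displacement

/-! ### Stability of quasi-geodesics -/

section Morse

variable {S : Type*} [MetricSpace S] {κ : ℝ}

/-- A 1-Lipschitz path of length at most `2 ^ k` passes at distance about `k κ` from every point
of a geodesic between its ends. -/
theorem FourPoint.exists_near_path (h : FourPoint S κ) {f : ℝ → S} (p : S) (k : ℕ) :
    ∀ a b : ℝ, a ≤ b → b - a ≤ 2 ^ k →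
      (∀ s t, a ≤ s → s ≤ t → t ≤ b → dist (f s) (f t) ≤ t - s) →
      ∃ t ∈ Set.Icc a b, 2 * dist p (f t) ≤ excess (f a) (f b) p + k * κ + 2 := by
  induction k with
  | zero =>
    intro a b hab hlen hf
    refine ⟨a, ⟨le_rfl, hab⟩, ?_⟩
    have h1 := hf a b le_rfl hab le_rfl
    have h2 := dist_triangle p (f b) (f a)
    rw [dist_comm (f b) (f a)] at h2
    simp only [pow_zero] at hlen
    unfold excess
    rw [dist_comm (f a) p]
    push_cast
    linarith
  | succ k ih =>
    intro a b hab hlen hf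
    set m := (a + b) / 2 with hm
    have ham : a ≤ m := by linarith
    have hmb : m ≤ b := by linarith
    rw [pow_succ] at hlen
    have hex := h.min_excess_le (f a) (f m) (f b) p
    rcases min_le_iff.1 hex with hex | hex
    · obtain ⟨t, ht, hd⟩ := ih a m ham (by linarith)
        (fun s t h1 h2 h3 => hf s t h1 h2 (h3.trans hmb))
      refine ⟨t, ⟨ht.1, ht.2.trans hmb⟩, ?_⟩
      push_cast
      linarith
    · obtain ⟨t, ht, hd⟩ := ih m b hmb (by linarith)
        (fun s t h1 h2 h3 => hf s t (ham.trans h1) h2 h3)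
      refine ⟨t, ⟨ham.trans ht.1, ht.2⟩, ?_⟩
      push_cast
      linarith

/-- Logarithmic growth forces boundedness. -/
theorem exists_bound_of_log_growth {κ : ℝ} (hκ : 0 < κ) (C : ℝ) :
    ∃ D : ℝ, ∀ M : ℝ, (∀ k : ℕ, 12 * M + C ≤ 2 ^ k → M ≤ 2 + (k + 1) * κ) → M ≤ D := by
  have hlim : Tendsto (fun k : ℕ => (k : ℝ) / 2 ^ k) atTop (𝓝 0) := by
    simpa using tendsto_pow_const_div_const_pow_of_one_lt 1 (show (1 : ℝ) < 2 by norm_num)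
  have hlim' : Tendsto (fun k : ℕ => (1 : ℝ) / 2 ^ k) atTop (𝓝 0) := by
    simpa using tendsto_pow_const_div_const_pow_of_one_lt 0 (show (1 : ℝ) < 2 by norm_num)
  have hsum := (hlim.const_mul (12 * κ)).add (hlim'.const_mul (12 * (2 + 2 * κ) + C))
  simp only [mul_zero, add_zero] at hsum
  obtain ⟨k₀, hk₀⟩ := eventually_atTop.1 (hsum.eventually_lt_const (show (0 : ℝ) < 1 by norm_num))
  have hk : ∀ k ≥ k₀, 12 * (2 + (k + 2) * κ) + C ≤ 2 ^ k := by
    intro k hk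
    have h1 := hk₀ k hk
    have h2 : (0 : ℝ) < 2 ^ k := by positivity
    have h3 : 12 * κ * ((k : ℝ) / 2 ^ k) + (12 * (2 + 2 * κ) + C) * (1 / 2 ^ k) =
        (12 * (2 + (k + 2) * κ) + C) / 2 ^ k := by ring
    rw [h3, div_lt_one h2] at h1
    exact h1.le
  refine ⟨2 + (k₀ + 1) * κ, fun M hM => ?_⟩
  by_contra! hlt
  -- The exponent with `2 + (k + 1) * κ < M ≤ 2 + (k + 2) * κ`; the upper bound verifies the premise
  -- of `hM`, the lower one refutes its conclusion.
  set k := ⌈(M - 2) / κ⌉₊ - 2 with hkdef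
  have h1 : (k₀ : ℝ) + 1 < (M - 2) / κ := by rw [lt_div_iff₀ hκ]; linarith
  have h2 : k₀ + 1 < ⌈(M - 2) / κ⌉₊ := by
    rw [Nat.lt_ceil]; push_cast; exact h1
  have h3 : ⌈(M - 2) / κ⌉₊ = k + 2 := by omega
  have h4 : (M - 2) / κ ≤ k + 2 := by
    have := Nat.le_ceil ((M - 2) / κ)
    rw [h3] at this
    exact_mod_cast this
  have h5 : (k : ℝ) + 1 < (M - 2) / κ := by
    have : k + 1 < ⌈(M - 2) / κ⌉₊ := by omega
    rw [Nat.lt_ceil] at this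
    exact_mod_cast this
  rw [div_le_iff₀ hκ] at h4
  rw [lt_div_iff₀ hκ] at h5
  have h6 := hk k (by omega)
  have h7 := hM k (by linarith)
  linarith

/-- Geodesics stay close to 1-Lipschitz quasi-geodesics with the same ends. -/
theorem FourPoint.exists_morse (h : FourPoint S κ) (hκ : 0 < κ) (hgeo : HasGeodesics S) (C : ℝ) :
    ∃ D : ℝ, ∀ (f : ℝ → S) (ℓ : ℝ), 0 ≤ ℓ →
      (∀ s t, 0 ≤ s → s ≤ t → t ≤ ℓ → dist (f s) (f t) ≤ t - s) →
      (∀ s t, 0 ≤ s → s ≤ t → t ≤ ℓ → t - s ≤ 2 * dist (f s) (f t) + C) →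
      ∀ p, excess (f 0) (f ℓ) p ≤ κ → ∃ t ∈ Set.Icc 0 ℓ, dist p (f t) ≤ D := by
  -- The piece of path used below has ends at distance at most `6 * M + 2`, hence length at most `12
  -- * M + 4 + C`.
  obtain ⟨D, hD⟩ := exists_bound_of_log_growth hκ (4 + C)
  refine ⟨max D (1 + κ) + 1 + 2 * κ, fun f ℓ hℓ hf hq p hp => ?_⟩
  obtain ⟨c, h0, h1, hc⟩ := hgeo (f 0) (f ℓ)
  set T := dist (f 0) (f ℓ) with hT
  have hT0 : 0 ≤ T := dist_nonneg
  set F := f '' Set.Icc 0 ℓ with hF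
  have hFne : F.Nonempty := ⟨f 0, 0, ⟨le_rfl, hℓ⟩, rfl⟩
  set m : ℝ → ℝ := fun s => Metric.infDist (c s) F with hm
  have h0F : f 0 ∈ F := ⟨0, ⟨le_rfl, hℓ⟩, rfl⟩
  have hℓF : f ℓ ∈ F := ⟨ℓ, ⟨hℓ, le_rfl⟩, rfl⟩
  have hc0 : ∀ s ∈ Set.Icc 0 T, dist (c s) (f 0) = s := by
    intro s hs
    have := hc s hs 0 ⟨le_rfl, hT0⟩
    rwa [h0, sub_zero, abs_of_nonneg hs.1] at this
  have hc1 : ∀ s ∈ Set.Icc 0 T, dist (c s) (f ℓ) = T - s := by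
    intro s hs
    have := hc s hs T ⟨hT0, le_rfl⟩
    rwa [h1, abs_sub_comm, abs_of_nonneg (sub_nonneg.2 hs.2)] at this
  have hbdd : BddAbove (m '' Set.Icc 0 T) := by
    refine ⟨T, ?_⟩
    rintro _ ⟨s, hs, rfl⟩
    have : m s ≤ dist (c s) (f 0) := Metric.infDist_le_dist_of_mem h0F
    rw [hc0 s hs] at this
    exact this.trans hs.2
  set M := sSup (m '' Set.Icc 0 T) with hM
  have hmM : ∀ s ∈ Set.Icc 0 T, m s ≤ M := fun s hs => le_csSup hbdd ⟨s, hs, rfl⟩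
  have hM0 : 0 ≤ M := Metric.infDist_nonneg.trans (hmM 0 ⟨le_rfl, hT0⟩)
  have hnear : ∀ s ∈ Set.Icc 0 T, ∃ t ∈ Set.Icc 0 ℓ, dist (c s) (f t) < M + 1 := by
    intro s hs
    have hlt : m s < M + 1 := by linarith [hmM s hs]
    obtain ⟨_, ⟨t, ht, rfl⟩, hd⟩ := (Metric.infDist_lt_iff hFne).1 hlt
    exact ⟨t, ht, hd⟩
  have hMD : M ≤ max D (1 + κ) := by
    obtain ⟨_, ⟨s, hs, rfl⟩, hsM⟩ := exists_lt_of_lt_csSup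
      (⟨m 0, 0, ⟨le_rfl, hT0⟩, rfl⟩ : (m '' Set.Icc 0 T).Nonempty) (sub_lt_self M one_pos)
    have hfar : ∀ t ∈ Set.Icc 0 ℓ, M - 1 ≤ dist (c s) (f t) := fun t ht =>
      hsM.le.trans (Metric.infDist_le_dist_of_mem ⟨t, ht, rfl⟩)
    -- Step back `2 * M` from the nearly worst point `c s`, or to the end of the geodesic, and cross
    -- to the path. The crossing is too short to come near `c s`, so unless `M` is small, the
    -- four-point inequality makes the chord between the two crossing points pass near `c s`.
    obtain ⟨s₁, hs₁, hs₁s, hs₁', t₁, ht₁, hd₁, he₁⟩ : ∃ s₁ ∈ Set.Icc 0 T, s₁ ≤ s ∧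
        s - s₁ ≤ 2 * M ∧ ∃ t₁ ∈ Set.Icc 0 ℓ, dist (c s₁) (f t₁) ≤ M + 1 ∧
          2 * M - 2 ≤ excess (c s₁) (f t₁) (c s) := by
      by_cases hcase : 2 * M ≤ s
      · have hmem : s - 2 * M ∈ Set.Icc 0 T := ⟨by linarith, by linarith [hs.2]⟩
        obtain ⟨t, ht, hd⟩ := hnear _ hmem
        refine ⟨s - 2 * M, hmem, by linarith, by linarith, t, ht, hd.le, ?_⟩
        have e := hc _ hmem s hs
        rw [abs_sub_comm, abs_of_nonneg (by linarith)] at e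
        have tri := dist_triangle (c (s - 2 * M)) (f t) (c s)
        rw [dist_comm (f t) (c s)] at tri
        unfold excess
        linarith
      · refine ⟨0, ⟨le_rfl, hT0⟩, hs.1, by linarith, 0, ⟨le_rfl, hℓ⟩, ?_, ?_⟩
        · rw [h0, dist_self]; linarith
        · have := hfar 0 ⟨le_rfl, hℓ⟩
          rw [h0]
          unfold excess
          rw [dist_self, dist_comm (f 0) (c s)]
          linarith
    obtain ⟨s₂, hs₂, hs₂s, hs₂', t₂, ht₂, hd₂, he₂⟩ : ∃ s₂ ∈ Set.Icc 0 T, s ≤ s₂ ∧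
        s₂ - s ≤ 2 * M ∧ ∃ t₂ ∈ Set.Icc 0 ℓ, dist (c s₂) (f t₂) ≤ M + 1 ∧
          2 * M - 2 ≤ excess (f t₂) (c s₂) (c s) := by
      by_cases hcase : s + 2 * M ≤ T
      · have hmem : s + 2 * M ∈ Set.Icc 0 T := ⟨by linarith [hs.1], hcase⟩
        obtain ⟨t, ht, hd⟩ := hnear _ hmem
        refine ⟨s + 2 * M, hmem, by linarith, by linarith, t, ht, hd.le, ?_⟩
        have e := hc s hs _ hmem
        rw [abs_sub_comm, abs_of_nonneg (by linarith)] at e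
        have tri := dist_triangle (c s) (f t) (c (s + 2 * M))
        rw [dist_comm (f t) (c (s + 2 * M))] at tri
        unfold excess
        rw [dist_comm (f t) (c s), dist_comm (f t) (c (s + 2 * M))]
        linarith
      · refine ⟨T, ⟨hT0, le_rfl⟩, hs.2, by linarith, ℓ, ⟨hℓ, le_rfl⟩, ?_, ?_⟩
        · rw [h1, dist_self]; linarith
        · have := hfar ℓ ⟨hℓ, le_rfl⟩
          rw [h1]
          unfold excess
          rw [dist_self, dist_comm (f ℓ) (c s)]
          linarith
    have hzero : excess (c s₁) (c s₂) (c s) = 0 := by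
      unfold excess
      rw [hc s₁ hs₁ s hs, hc s hs s₂ hs₂, hc s₁ hs₁ s₂ hs₂, abs_sub_comm s₁ s, abs_sub_comm s s₂,
        abs_sub_comm s₁ s₂, abs_of_nonneg (by linarith), abs_of_nonneg (by linarith),
        abs_of_nonneg (by linarith)]
      ring
    have m1 := h.min_excess_le (c s₁) (f t₁) (c s₂) (c s)
    have m2 := h.min_excess_le (f t₁) (f t₂) (c s₂) (c s)
    rw [hzero] at m1
    have hends : dist (f t₁) (f t₂) ≤ 6 * M + 2 := by
      have e := hc s₁ hs₁ s₂ hs₂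
      rw [abs_sub_comm, abs_of_nonneg (by linarith)] at e
      have := dist_triangle4 (f t₁) (c s₁) (c s₂) (f t₂)
      rw [dist_comm (f t₁) (c s₁)] at this
      linarith
    have hmid : excess (f t₁) (f t₂) (c s) ≤ 2 * κ → M ≤ D := by
      intro hex
      refine hD M fun k hk => ?_
      obtain ⟨t, ht, hdt⟩ : ∃ t ∈ Set.Icc 0 ℓ,
          2 * dist (c s) (f t) ≤ excess (f t₁) (f t₂) (c s) + k * κ + 2 := by
        rcases le_total t₁ t₂ with hle | hle
        · have hlen := hq t₁ t₂ ht₁.1 hle ht₂.2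
          obtain ⟨t, ht, hdt⟩ := h.exists_near_path (f := f) (c s) k t₁ t₂ hle (by linarith)
            (fun a b h1 h2 h3 => hf a b (ht₁.1.trans h1) h2 (h3.trans ht₂.2))
          exact ⟨t, ⟨ht₁.1.trans ht.1, ht.2.trans ht₂.2⟩, hdt⟩
        · have hlen := hq t₂ t₁ ht₂.1 hle ht₁.2
          rw [dist_comm] at hlen
          obtain ⟨t, ht, hdt⟩ := h.exists_near_path (f := f) (c s) k t₂ t₁ hle (by linarith)
            (fun a b h1 h2 h3 => hf a b (ht₂.1.trans h1) h2 (h3.trans ht₁.2))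
          rw [excess_comm (f t₂) (f t₁)] at hdt
          exact ⟨t, ⟨ht₂.1.trans ht.1, ht.2.trans ht₁.2⟩, hdt⟩
      have := hfar t ht
      have hk0 : 0 ≤ (k : ℝ) * κ := by positivity
      linarith
    rcases min_le_iff.1 m1 with m1 | m1
    · exact le_max_of_le_right (by linarith)
    · rcases min_le_iff.1 m2 with m2 | m2
      · exact le_max_of_le_left (hmid (by linarith))
      · exact le_max_of_le_right (by linarith)
  obtain ⟨s, hs, hps⟩ : ∃ s ∈ Set.Icc 0 T, dist p (c s) ≤ 2 * κ := by
    unfold excess at hp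
    rcases le_total (dist (f 0) p) T with hle | hle
    · have hmem : dist (f 0) p ∈ Set.Icc 0 T := ⟨dist_nonneg, hle⟩
      refine ⟨_, hmem, ?_⟩
      have h4 := h p (c (dist (f 0) p)) (f 0) (f ℓ)
      rw [hc0 _ hmem, hc1 _ hmem, dist_comm p (f 0)] at h4
      rcases le_max_iff.1 (sub_le_iff_le_add.2 h4) with h5 | h5 <;> linarith
    · exact ⟨T, ⟨hT0, le_rfl⟩, by rw [h1]; linarith⟩
  obtain ⟨t, ht, hd⟩ := hnear s hs
  refine ⟨t, ht, ?_⟩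
  have := dist_triangle p (c s) (f t)
  linarith

end Morse

/-! ### Discounted distances -/

section Routes

variable {Γ S : Type*} [Group Γ] [MetricSpace S] [MulAction Γ S]

/-- `Route x₀ w Δ x y c`: a chain of `c` total cost leads from `x` to `y`, where one may walk at
the cost of the distance, and jump from a translate of `x₀` to the same translate of `w • x₀` at
the cost of the distance minus `Δ`. -/
inductive Route (x₀ : S) (w : Γ) (Δ : ℝ) (x : S) : S → ℝ → Prop
  | nil : Route x₀ w Δ x x 0
  | walk {y : S} {c : ℝ} (z : S) : Route x₀ w Δ x y c → Route x₀ w Δ x z (c + dist y z)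
  | jump {c : ℝ} (γ : Γ) : Route x₀ w Δ x (γ • x₀) c →
      Route x₀ w Δ x (γ • w • x₀) (c + (dist x₀ (w • x₀) - Δ))

/-- The infimal cost of a route. -/
noncomputable def routeDist (x₀ : S) (w : Γ) (Δ : ℝ) (x y : S) : ℝ :=
  sInf {c | Route x₀ w Δ x y c}

variable {x₀ : S} {w : Γ} {Δ : ℝ} {x y z : S} {c c' : ℝ}

theorem Route.congr (h : Route x₀ w Δ x y c) (hc : c = c') : Route x₀ w Δ x y c' := hc ▸ h

theorem Route.trans (h : Route x₀ w Δ x y c) (h' : Route x₀ w Δ y z c') :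
    Route x₀ w Δ x z (c + c') := by
  induction h' with
  | nil => simpa using h
  | walk z _ ih => exact (ih.walk z).congr (by ring)
  | jump γ _ ih => exact (ih.jump γ).congr (by ring)

theorem route_dist (x y : S) : Route x₀ w Δ x y (dist x y) :=
  (Route.nil.walk y).congr (by ring)

theorem route_jump (γ : Γ) : Route x₀ w Δ (γ • x₀) (γ • w • x₀) (dist x₀ (w • x₀) - Δ) :=
  (Route.nil.jump γ).congr (by ring)

/-- A route cheaper than walking must contain a jump; the induction splits it at the last one. -/
theorem Route.dist_le_or (h : Route x₀ w Δ x y c) :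
    dist x y ≤ c ∨ ∃ (γ : Γ) (c₁ c₂ : ℝ), Route x₀ w Δ x (γ • x₀) c₁ ∧
      Route x₀ w Δ (γ • w • x₀) y c₂ ∧ c₁ + (dist x₀ (w • x₀) - Δ) + c₂ = c := by
  induction h with
  | nil => left; simp
  | @walk y c z h ih =>
    rcases ih with ih | ⟨γ, c₁, c₂, h1, h2, he⟩
    · left
      linarith [dist_triangle x y z]
    · right
      exact ⟨γ, c₁, c₂ + dist y z, h1, h2.walk z, by linarith⟩
  | @jump c γ h ih =>
    right
    exact ⟨γ, c, 0, h, Route.nil, by ring⟩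

theorem exists_route_lt (x y : S) {ε : ℝ} (hε : 0 < ε) :
    ∃ c, Route x₀ w Δ x y c ∧ c < routeDist x₀ w Δ x y + ε :=
  exists_lt_of_csInf_lt ⟨_, route_dist x y⟩ (lt_add_of_pos_right _ hε)

variable [IsIsometricSMul Γ S]

theorem Route.smul (h : Route x₀ w Δ x y c) (g : Γ) : Route x₀ w Δ (g • x) (g • y) c := by
  induction h with
  | nil => exact Route.nil
  | @walk y c z _ ih => exact (ih.walk (g • z)).congr (by rw [dist_smul])
  | @jump c γ _ ih =>
    rw [← mul_smul] at ih
    have := ih.jump (g * γ)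
    rwa [mul_smul] at this

theorem route_smul_iff (g : Γ) : Route x₀ w Δ (g • x) (g • y) c ↔ Route x₀ w Δ x y c :=
  ⟨fun h => by simpa using h.smul g⁻¹, fun h => h.smul g⟩

theorem routeDist_smul (g : Γ) (x y : S) :
    routeDist x₀ w Δ (g • x) (g • y) = routeDist x₀ w Δ x y := by
  simp only [routeDist, route_smul_iff]

/-- The condition `hL` keeps the price of a jump at no less than half its length, so the discounted
distance stays comparable with `dist`. -/
theorem Route.half_dist_le (hL : 2 * Δ ≤ dist x₀ (w • x₀))
    (h : Route x₀ w Δ x y c) : dist x y / 2 ≤ c := by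
  induction h with
  | nil => simp
  | @walk y c z _ ih => linarith [dist_triangle x y z, dist_nonneg (x := y) (y := z)]
  | @jump c γ _ ih =>
    have := dist_triangle x (γ • x₀) (γ • w • x₀)
    rw [dist_smul] at this
    linarith

theorem routeDist_le (hL : 2 * Δ ≤ dist x₀ (w • x₀)) (h : Route x₀ w Δ x y c) :
    routeDist x₀ w Δ x y ≤ c :=
  csInf_le ⟨0, fun _ hc => (by positivity : 0 ≤ dist x y / 2).trans (hc.half_dist_le hL)⟩ h

theorem half_dist_le_routeDist (hL : 2 * Δ ≤ dist x₀ (w • x₀)) (x y : S) :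
    dist x y / 2 ≤ routeDist x₀ w Δ x y :=
  le_csInf ⟨_, route_dist x y⟩ fun _ hc => hc.half_dist_le hL

theorem routeDist_le_dist (hL : 2 * Δ ≤ dist x₀ (w • x₀)) (x y : S) :
    routeDist x₀ w Δ x y ≤ dist x y :=
  routeDist_le hL (route_dist x y)

theorem routeDist_triangle (hL : 2 * Δ ≤ dist x₀ (w • x₀)) (x y z : S) :
    routeDist x₀ w Δ x z ≤ routeDist x₀ w Δ x y + routeDist x₀ w Δ y z := by
  refine le_of_forall_pos_le_add fun ε hε => ?_
  obtain ⟨c, hc, hc'⟩ := exists_route_lt (x₀ := x₀) (w := w) (Δ := Δ) x y (half_pos hε)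
  obtain ⟨d, hd, hd'⟩ := exists_route_lt (x₀ := x₀) (w := w) (Δ := Δ) y z (half_pos hε)
  linarith [routeDist_le hL (hc.trans hd)]

/-- Routes are realized by 1-Lipschitz paths `f` with a function `u` recording the cost. -/
theorem Route.exists_path (hL : 2 * Δ ≤ dist x₀ (w • x₀))
    (hgeo : HasGeodesics S) (hΔ : 0 ≤ Δ) (h : Route x₀ w Δ x y c) :
    ∃ (ℓ : ℝ) (f : ℝ → S) (u : ℝ → ℝ), 0 ≤ ℓ ∧ f 0 = x ∧ f ℓ = y ∧ u 0 = 0 ∧ u ℓ = c ∧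
      ∀ s t, 0 ≤ s → s ≤ t → t ≤ ℓ → dist (f s) (f t) ≤ t - s ∧
        routeDist x₀ w Δ (f s) (f t) ≤ u t - u s + Δ ∧ (t - s) / 2 - Δ ≤ u t - u s := by
  -- Concatenation with one more piece. Measured from its starting point, the new piece must satisfy
  -- the bounds without the error `Δ`; otherwise the errors would accumulate with the number of
  -- pieces.
  have append : ∀ {y z : S} {c : ℝ} (T : ℝ) (g : ℝ → S) (v : ℝ → ℝ), 0 ≤ T → g 0 = y → g T = z →
      v 0 = 0 →
      (∀ s t, 0 ≤ s → s ≤ t → t ≤ T → dist (g s) (g t) ≤ t - s ∧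
        routeDist x₀ w Δ (g s) (g t) ≤ v t - v s + Δ ∧ (t - s) / 2 - Δ ≤ v t - v s) →
      (∀ t, 0 ≤ t → t ≤ T → routeDist x₀ w Δ y (g t) ≤ v t ∧ t / 2 ≤ v t) →
      (∃ (ℓ : ℝ) (f : ℝ → S) (u : ℝ → ℝ), 0 ≤ ℓ ∧ f 0 = x ∧ f ℓ = y ∧ u 0 = 0 ∧ u ℓ = c ∧
        ∀ s t, 0 ≤ s → s ≤ t → t ≤ ℓ → dist (f s) (f t) ≤ t - s ∧
          routeDist x₀ w Δ (f s) (f t) ≤ u t - u s + Δ ∧ (t - s) / 2 - Δ ≤ u t - u s) →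
      ∃ (ℓ : ℝ) (f : ℝ → S) (u : ℝ → ℝ), 0 ≤ ℓ ∧ f 0 = x ∧ f ℓ = z ∧ u 0 = 0 ∧ u ℓ = c + v T ∧
        ∀ s t, 0 ≤ s → s ≤ t → t ≤ ℓ → dist (f s) (f t) ≤ t - s ∧
          routeDist x₀ w Δ (f s) (f t) ≤ u t - u s + Δ ∧ (t - s) / 2 - Δ ≤ u t - u s := by
    rintro y z c T g v hT hg0 hgT hv0 hg hgv ⟨ℓ, f, u, hℓ, hf0, hfℓ, hu0, huℓ, hf⟩
    have hf' : ∀ t, ℓ ≤ t → (if t ≤ ℓ then f t else g (t - ℓ)) = g (t - ℓ) := by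
      intro t ht
      split_ifs with h
      · rw [le_antisymm h ht, hfℓ, sub_self, hg0]
      · rfl
    have hu' : ∀ t, ℓ ≤ t → (if t ≤ ℓ then u t else c + v (t - ℓ)) = c + v (t - ℓ) := by
      intro t ht
      split_ifs with h
      · rw [le_antisymm h ht, huℓ, sub_self, hv0, add_zero]
      · rfl
    refine ⟨ℓ + T, fun t => if t ≤ ℓ then f t else g (t - ℓ),
      fun t => if t ≤ ℓ then u t else c + v (t - ℓ), by linarith, ?_, ?_, ?_, ?_, ?_⟩
    · simp only [if_pos hℓ, hf0]
    · exact (hf' (ℓ + T) (by linarith)).trans (by rw [add_sub_cancel_left, hgT])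
    · simp only [if_pos hℓ, hu0]
    · exact (hu' (ℓ + T) (by linarith)).trans (by rw [add_sub_cancel_left])
    · intro s t hs hst ht
      dsimp only
      rcases le_total t ℓ with htl | htl
      · rw [if_pos htl, if_pos (hst.trans htl), if_pos htl, if_pos (hst.trans htl)]
        exact hf s t hs hst htl
      · rw [hf' t htl, hu' t htl]
        rcases le_total s ℓ with hsl | hsl
        · rw [if_pos hsl, if_pos hsl]
          obtain ⟨a1, a2, a3⟩ := hf s ℓ hs hsl le_rfl
          obtain ⟨b1, -, -⟩ := hg 0 (t - ℓ) le_rfl (by linarith) (by linarith)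
          obtain ⟨b2, b3⟩ := hgv (t - ℓ) (by linarith) (by linarith)
          rw [hg0] at b1
          rw [hfℓ] at a1 a2
          rw [huℓ] at a2 a3
          have t1 := dist_triangle (f s) y (g (t - ℓ))
          have t2 := routeDist_triangle hL (f s) y (g (t - ℓ))
          refine ⟨by linarith, by linarith, by linarith⟩
        · rw [hf' s hsl, hu' s hsl]
          obtain ⟨a1, a2, a3⟩ := hg (s - ℓ) (t - ℓ) (by linarith) (by linarith) (by linarith)
          refine ⟨by linarith, by linarith, by linarith⟩
  induction h with
  | nil =>
    refine ⟨0, fun _ => x, fun _ => 0, le_rfl, rfl, rfl, rfl, rfl, fun s t hs hst ht => ?_⟩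
    have h1 := routeDist_le_dist hL x x
    rw [dist_self] at h1
    have : s = t := by linarith
    subst this
    simp only [dist_self, sub_self, zero_add, zero_div]
    exact ⟨le_rfl, h1.trans hΔ, by linarith⟩
  | @walk y c z _ ih =>
    obtain ⟨g, hg0, hg1, hg⟩ := hgeo y z
    have hgd : ∀ s t, 0 ≤ s → s ≤ t → t ≤ dist y z → dist (g s) (g t) = t - s := by
      intro s t hs hst ht
      rw [hg s ⟨hs, hst.trans ht⟩ t ⟨hs.trans hst, ht⟩, abs_sub_comm,
        abs_of_nonneg (by linarith)]
    refine append (dist y z) g (fun t => t) dist_nonneg hg0 hg1 rfl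
      (fun s t hs hst ht => ?_) (fun t ht0 ht => ?_) ih
    · have h1 := hgd s t hs hst ht
      have h2 := routeDist_le_dist hL (g s) (g t)
      refine ⟨h1.le, by linarith, by linarith⟩
    · have h1 := hgd 0 t le_rfl ht0 ht
      have h2 := routeDist_le_dist hL (g 0) (g t)
      rw [hg0] at h1 h2
      exact ⟨by linarith, by linarith⟩
  | @jump c γ _ ih =>
    set T := dist x₀ (w • x₀) with hT
    obtain ⟨g, hg0, hg1, hg⟩ := hgeo (γ • x₀) (γ • w • x₀)
    rw [dist_smul, ← hT] at hg1 hg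
    have hT0 : 0 ≤ T := dist_nonneg
    have hgd : ∀ s t, 0 ≤ s → s ≤ t → t ≤ T → dist (g s) (g t) = t - s := by
      intro s t hs hst ht
      rw [hg s ⟨hs, hst.trans ht⟩ t ⟨hs.trans hst, ht⟩, abs_sub_comm,
        abs_of_nonneg (by linarith)]
    rcases hT0.eq_or_lt with hT0' | hTpos
    · have hΔ0 : Δ = 0 := by linarith
      refine append T g (fun t => t - Δ) hT0 hg0 hg1 (by linarith)
        (fun s t hs hst ht => ?_) (fun t ht0 ht => ?_) ih
      · have h1 := hgd s t hs hst ht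
        have h2 := routeDist_le_dist hL (g s) (g t)
        refine ⟨h1.le, by linarith, by linarith⟩
      · have h1 := hgd 0 t le_rfl ht0 ht
        have h2 := routeDist_le_dist hL (g 0) (g t)
        rw [hg0] at h1 h2
        exact ⟨by linarith, by linarith⟩
    -- The discount is credited only at the end of the jump, so `u` drops by `Δ` there. This needs
    -- `T > 0`, so that the recorded cost still starts at `0`.
    · have hend := append T g (fun t => if t < T then t else T - Δ) hT0 hg0 hg1 (if_pos hTpos)
        (fun s t hs hst ht => ?_) (fun t ht0 ht => ?_) ih
      · simpa only [lt_irrefl, if_false] using hend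
      · have h1 := hgd s t hs hst ht
        have h2 := routeDist_le_dist hL (g s) (g t)
        refine ⟨h1.le, ?_, ?_⟩ <;> split_ifs <;> linarith
      · have h1 := hgd 0 t le_rfl ht0 ht
        have h2 := routeDist_le_dist hL (g 0) (g t)
        rw [hg0] at h1 h2
        split_ifs with htT
        · exact ⟨by linarith, by linarith⟩
        · obtain rfl : t = T := le_antisymm ht (not_lt.1 htT)
          rw [hg1]
          exact ⟨routeDist_le hL (route_jump γ), by linarith⟩

/-- The discounted distance is almost additive along geodesics, uniformly in `x₀` and `w`. -/
theorem FourPoint.exists_routeDist_add_le {κ : ℝ} (h : FourPoint S κ) (hκ : 0 < κ)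
    (hgeo : HasGeodesics S) (hΔ : 0 ≤ Δ) :
    ∃ C : ℝ, ∀ (x₀ : S) (w : Γ), 2 * Δ ≤ dist x₀ (w • x₀) → ∀ x y p : S, excess x y p ≤ κ →
      routeDist x₀ w Δ x p + routeDist x₀ w Δ p y ≤ routeDist x₀ w Δ x y + C := by
  -- A route within `1` of optimal satisfies `u t - u s ≤ dist (f s) (f t) + 2 * Δ + 1`; with `(t -
  -- s) / 2 - Δ ≤ u t - u s` this gives the additive constant.
  obtain ⟨D, hD⟩ := h.exists_morse hκ hgeo (6 * Δ + 2)
  refine ⟨2 * D + 2 * Δ + 1, fun x₀ w hL x y p hp => ?_⟩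
  obtain ⟨c, hc, hc'⟩ := exists_route_lt (x₀ := x₀) (w := w) (Δ := Δ) x y one_pos
  obtain ⟨ℓ, f, u, hℓ, hf0, hfℓ, hu0, huℓ, hf⟩ := hc.exists_path hL hgeo hΔ
  have hpre : ∀ t, 0 ≤ t → t ≤ ℓ → routeDist x₀ w Δ x (f t) ≤ u t + Δ := by
    intro t h0 h1
    have := (hf 0 t le_rfl h0 h1).2.1
    rwa [hf0, hu0, sub_zero] at this
  have hpost : ∀ t, 0 ≤ t → t ≤ ℓ → routeDist x₀ w Δ (f t) y ≤ c - u t + Δ := by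
    intro t h0 h1
    have := (hf t ℓ h0 h1 le_rfl).2.1
    rwa [hfℓ, huℓ] at this
  rw [← hf0, ← hfℓ] at hp
  obtain ⟨t, ht, hd⟩ := hD f ℓ hℓ (fun s t h0 h1 h2 => (hf s t h0 h1 h2).1)
    (fun s t h0 h1 h2 => by
      have k1 := hpre s h0 (h1.trans h2)
      have k2 := hpost t (h0.trans h1) h2
      have k3 := (hf s t h0 h1 h2).2.2
      have k4 := routeDist_triangle hL x (f s) y
      have k5 := routeDist_triangle hL (f s) (f t) y
      have k6 := routeDist_le_dist hL (f s) (f t)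
      linarith) p hp
  have k1 := hpre t ht.1 ht.2
  have k2 := hpost t ht.1 ht.2
  have k3 := routeDist_triangle hL x (f t) p
  have k4 := routeDist_triangle hL p (f t) y
  have k5 := routeDist_le_dist hL p (f t)
  have k6 := routeDist_le_dist hL (f t) p
  rw [dist_comm] at k6
  linarith

/-- Near-optimal intermediate points of routes lie close to geodesics. -/
theorem excess_le_of_routeDist_add_le {κ C E : ℝ} (hL : 2 * Δ ≤ dist x₀ (w • x₀))
    (h : FourPoint S κ) (hκ : 0 < κ) (hgeo : HasGeodesics S)
    (hC : ∀ x y p : S, excess x y p ≤ κ →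
      routeDist x₀ w Δ x p + routeDist x₀ w Δ p y ≤ routeDist x₀ w Δ x y + C) {x y q : S}
    (hq : routeDist x₀ w Δ x q + routeDist x₀ w Δ q y ≤ routeDist x₀ w Δ x y + E) :
    excess x y q ≤ κ + 2 * (2 * C + E) := by
  -- Almost additivity through the centre shows that the detour from `p` to `q` and back costs at
  -- most `2 * C + E`, hence `dist p q ≤ 2 * C + E`.
  obtain ⟨p, hp1, hp2, hp3⟩ := h.exists_center hκ.le hgeo x q y
  have k1 := hC _ _ _ hp1
  have k2 := hC _ _ _ hp2
  have k3 := routeDist_triangle hL x p y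
  have k4 := half_dist_le_routeDist hL p q
  have k5 := half_dist_le_routeDist hL q p
  have k6 := excess_le_two_mul_dist_add x y q p
  rw [dist_comm p q] at k4
  linarith

end Routes

/-! ### Quasi-morphisms and stable commutator length -/

section Quasimorphism

open scoped commutatorElement

variable {Γ : Type*} [Group Γ]

theorem inv_mem_commutatorSet (a : Γ) (ha : a ∈ commutatorSet Γ) : a⁻¹ ∈ commutatorSet Γ := by
  obtain ⟨x, y, rfl⟩ := ha
  exact ⟨y, x, (commutatorElement_inv x y).symm⟩

/-- Three products cost `3 * D`, and each of the pairs `a, a⁻¹` and `b, b⁻¹` cancels up to `2 * D`,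
since `|φ 1| ≤ D`. -/
theorem abs_commutator_le {φ : Γ → ℝ} {D : ℝ} (hφ : ∀ a b, |φ (a * b) - φ a - φ b| ≤ D)
    (a b : Γ) : |φ ⁅a, b⁆| ≤ 7 * D := by
  have h1 := hφ 1 1
  have h2 := hφ a a⁻¹
  have h3 := hφ b b⁻¹
  have h4 := hφ a b
  have h5 := hφ (a * b) a⁻¹
  have h6 := hφ (a * b * a⁻¹) b⁻¹
  rw [mul_inv_cancel] at h2 h3
  rw [mul_one] at h1
  rw [commutatorElement_def]
  rw [abs_le] at *
  constructor <;> linarith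

/-- A quasi-morphism of defect `D` bounds commutator length from below. -/
theorem abs_le_wordNorm {φ : Γ → ℝ} {D : ℝ} (hφ : ∀ a b, |φ (a * b) - φ a - φ b| ≤ D)
    {g : Γ} (hg : g ∈ Subgroup.closure (commutatorSet Γ)) :
    |φ g| ≤ 8 * D * wordNorm (commutatorSet Γ) g + D := by
  have key : ∀ l : List Γ, (∀ a ∈ l, a ∈ commutatorSet Γ) → |φ l.prod| ≤ 8 * D * l.length + D := by
    intro l
    induction l with
    | nil =>
      intro _
      have h1 := hφ 1 1
      rw [mul_one] at h1
      simp only [List.prod_nil, List.length_nil, Nat.cast_zero, mul_zero, zero_add]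
      rw [abs_le] at *
      constructor <;> linarith
    | cons a l ih =>
      intro hl
      obtain ⟨x, y, hxy⟩ := hl a (by simp)
      have h1 := ih fun b hb => hl b (by simp [hb])
      have h2 := abs_commutator_le hφ x y
      have h3 := hφ a l.prod
      rw [hxy] at h2
      rw [List.prod_cons, List.length_cons]
      push_cast
      rw [abs_le] at *
      constructor <;> linarith
  obtain ⟨l, hl, hlA, rfl⟩ := exists_word inv_mem_commutatorSet hg
  rw [← hl]
  exact key l hlA

/-- If the commutator length of `(g ^ N) ^ n` grows at least at rate `B / E`, then the stable
commutator length of `g` is at least `B / (E N)`. -/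
theorem ofReal_le_scl {g : Γ} {N : ℕ} (hN : 0 < N) {B E F : ℝ} (hE : 0 < E)
    (h : ∀ n : ℕ, 0 < n → (g ^ N) ^ n ∈ Subgroup.closure (commutatorSet Γ) →
      n * B ≤ E * wordNorm (commutatorSet Γ) ((g ^ N) ^ n) + F) :
    ENNReal.ofReal (B / (E * N)) ≤ scl g := by
  have hN' : (0 : ℝ) < N := by exact_mod_cast hN
  by_cases hex : ∃ m : ℕ, 0 < m ∧ g ^ m ∈ Subgroup.closure (commutatorSet Γ)
  · obtain ⟨m, hm, hgm⟩ := hex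
    have hm' : (0 : ℝ) < m := by exact_mod_cast hm
    rw [scl, extStableWordNorm_eq inv_mem_commutatorSet hm hgm]
    refine ENNReal.ofReal_le_ofReal ?_
    rw [le_div_iff₀ hm']
    have h1 := (tendsto_stableWordNorm inv_mem_commutatorSet hgm).comp
      (tendsto_id.const_mul_atTop' hN)
    have h2 : Tendsto (fun n : ℕ => B / (E * N) * m - F / (E * N) / n) atTop
        (𝓝 (B / (E * N) * m - 0)) :=
      tendsto_const_nhds.sub (tendsto_const_div_atTop_nhds_zero_nat _)
    rw [sub_zero] at h2
    refine le_of_tendsto_of_tendsto h2 h1 ?_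
    filter_upwards [eventually_gt_atTop 0] with n hn
    have hn' : (0 : ℝ) < n := by exact_mod_cast hn
    -- The same element is read as a power of `g ^ N`, where the hypothesis applies, and of `g ^ m`,
    -- where the stable norm is computed.
    have hpow : (g ^ N) ^ (m * n) = (g ^ m) ^ (N * n) := by
      rw [← pow_mul, ← pow_mul]; congr 1; ring
    have h3 := h (m * n) (by positivity) (by rw [hpow]; exact pow_mem hgm _)
    rw [hpow] at h3
    simp only [Function.comp, id]
    push_cast at h3 ⊢
    rw [le_div_iff₀ (by positivity)]
    have e : (B / (E * N) * m - F / (E * N) / n) * (N * n) = (m * n * B - F) / E := by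
      field_simp
    rw [e, div_le_iff₀ hE]
    linarith
  · rw [scl, extStableWordNorm, dif_neg hex]
    exact le_top

/-- All powers of `g ^ (2 * m)` are single commutators, so their commutator length stays bounded. -/
theorem scl_eq_zero_of_isAchiral {g : Γ} (hg : IsAchiral g) : scl g = 0 := by
  obtain ⟨m, hm, hconj⟩ := hg
  obtain ⟨h, hh⟩ := isConj_iff.1 hconj
  have hcomm : ∀ k : ℕ, (g ^ (2 * m)) ^ k ∈ commutatorSet Γ := by
    intro k
    refine ⟨g ^ (m * k), h, ?_⟩
    have h1 : h * (g ^ (m * k))⁻¹ * h⁻¹ = g ^ (m * k) := by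
      rw [← conj_inv, pow_mul, ← conj_pow, hh, zpow_neg, zpow_natCast, inv_pow, inv_inv]
    rw [commutatorElement_def, mul_assoc, mul_assoc, ← mul_assoc h, h1, ← pow_add, ← pow_mul]
    congr 1; ring
  have hmem : g ^ (2 * m) ∈ Subgroup.closure (commutatorSet Γ) :=
    Subgroup.subset_closure (by simpa using hcomm 1)
  have hzero : stableWordNorm (commutatorSet Γ) (g ^ (2 * m)) = 0 := by
    refine tendsto_nhds_unique (tendsto_stableWordNorm inv_mem_commutatorSet hmem) ?_
    refine squeeze_zero (fun n => by positivity) (fun n => ?_)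
      (tendsto_const_div_atTop_nhds_zero_nat 1)
    have : wordNorm (commutatorSet Γ) ((g ^ (2 * m)) ^ n) ≤ 1 :=
      Nat.sInf_le ⟨[(g ^ (2 * m)) ^ n], rfl, by simpa using hcomm n, by simp⟩
    gcongr
    exact_mod_cast this
  rw [scl, extStableWordNorm_eq inv_mem_commutatorSet (by omega : 0 < 2 * m) hmem, hzero]
  simp

end Quasimorphism

/-! ### The gap theorem -/

section Gap

variable {Γ S : Type*} [Group Γ] [MetricSpace S] [MulAction Γ S] [IsIsometricSMul Γ S]

/-- The antisymmetrized discounted distance gives a quasi-morphism. -/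
theorem abs_routeDist_sub_le {κ C Δ : ℝ} {x₀ : S} {w : Γ}
    (hL : 2 * Δ ≤ dist x₀ (w • x₀)) (h : FourPoint S κ) (hκ : 0 < κ) (hgeo : HasGeodesics S)
    (hC : ∀ x y p : S, excess x y p ≤ κ →
      routeDist x₀ w Δ x p + routeDist x₀ w Δ p y ≤ routeDist x₀ w Δ x y + C) (a b : Γ) :
    |(routeDist x₀ w Δ x₀ ((a * b) • x₀) - routeDist x₀ w Δ ((a * b) • x₀) x₀) -
      (routeDist x₀ w Δ x₀ (a • x₀) - routeDist x₀ w Δ (a • x₀) x₀) -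
      (routeDist x₀ w Δ x₀ (b • x₀) - routeDist x₀ w Δ (b • x₀) x₀)| ≤ 3 * C := by
  rw [← routeDist_smul a x₀ (b • x₀), ← routeDist_smul a (b • x₀) x₀, ← mul_smul]
  set x := x₀
  set y := a • x₀
  set z := (a * b) • x₀
  -- Splitting the six oriented sides at the centre, all half-sides cancel; three of the errors lie
  -- in `[-C, 0]` and three in `[0, C]`.
  obtain ⟨p, h1, h2, h3⟩ := h.exists_center hκ.le hgeo x y z
  have a1 := hC x y p h1
  have a2 := hC y z p h2
  have a3 := hC x z p h3
  have b1 := hC y x p (by rwa [excess_comm])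
  have b2 := hC z y p (by rwa [excess_comm])
  have b3 := hC z x p (by rwa [excess_comm])
  have c1 := routeDist_triangle hL x p y
  have c2 := routeDist_triangle hL y p z
  have c3 := routeDist_triangle hL x p z
  have d1 := routeDist_triangle hL y p x
  have d2 := routeDist_triangle hL z p y
  have d3 := routeDist_triangle hL z p x
  rw [abs_le]
  constructor <;> linarith

/-- A translate of a long piece of the axis of `g` which runs along the axis backwards provides
elements with small displacement. -/
theorem FourPoint.dist_smul_le_of_reversed {κ τ B M : ℝ} (h : FourPoint S κ) (hκ : 0 < κ)
    {g γ : Γ} {x₀ : S} {N K : ℕ} (hNK : N ≤ K) (hτ0 : 0 ≤ τ) (hB : 0 ≤ B) (hM : 0 ≤ M)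
    (hlow : ∀ j : ℕ, j * τ ≤ dist x₀ (g ^ j • x₀))
    (hup : ∀ j ≤ K, dist x₀ (g ^ j • x₀) ≤ j * τ + B)
    (hγ : dist (g ^ K • x₀) (γ • x₀) + dist x₀ (g ^ N • x₀) + dist (γ • g ^ N • x₀) x₀ ≤
      dist (g ^ K • x₀) x₀ + M) {i j : ℕ} (hij : i ≤ j) (hjN : j ≤ N) :
    dist (γ • g ^ j • x₀) ((γ * g ^ i * γ⁻¹ * g ^ i) • γ • g ^ j • x₀) ≤
      2 * M + 4 * B + 2 * κ := by
  set P := g ^ K • x₀ with hP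
  set P' := g ^ (K - i) • x₀ with hP'
  set Z := γ • g ^ j • x₀ with hZ
  set A := γ • g ^ (j - i) • x₀ with hA
  have hiK : i ≤ K := by omega
  have ci : ((j - i : ℕ) : ℝ) = j - i := Nat.cast_sub hij
  have cN : ((N - j : ℕ) : ℝ) = N - j := Nat.cast_sub hjN
  have cK : ((K - i : ℕ) : ℝ) = K - i := Nat.cast_sub hiK
  have cA : ((N - (j - i) : ℕ) : ℝ) = N - (j - i) := by rw [Nat.cast_sub (by omega), ci]
  -- `g ^ i` pushes `Z` along the axis towards `P`, and its conjugate by `γ` pushes back. Undoing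
  -- the conjugate turns the claim into the closeness of `A` and `g ^ i • Z`, both about `i * τ`
  -- from `Z` on the side of `P`.
  have goal_eq : dist Z ((γ * g ^ i * γ⁻¹ * g ^ i) • Z) = dist A (g ^ i • Z) := by
    have e : Z = (γ * g ^ i * γ⁻¹) • A := by
      rw [hZ, hA, ← mul_smul, ← mul_smul, ← mul_smul]
      congr 1
      conv_lhs => rw [← Nat.add_sub_cancel' hij, pow_add]
      group
    rw [mul_smul (γ * g ^ i * γ⁻¹)]
    conv_lhs => rw [e]
    rw [dist_smul, ← e]
  rw [goal_eq]
  have dPA : dist P A ≤ dist P (γ • x₀) + ((j - i) * τ + B) := by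
    have h1 := dist_triangle P (γ • x₀) A
    have h2 := hup (j - i) (by omega)
    rw [hA, dist_smul] at h1
    rw [ci] at h2
    linarith
  have dPZ : dist P Z ≤ dist P (γ • x₀) + (j * τ + B) := by
    have h1 := dist_triangle P (γ • x₀) Z
    have h2 := hup j (by omega)
    rw [hZ, dist_smul] at h1
    linarith
  have dQA : dist A x₀ ≤ (N - (j - i)) * τ + B + dist (γ • g ^ N • x₀) x₀ := by
    have h1 := dist_triangle A (γ • g ^ N • x₀) x₀
    have h2 := hup (N - (j - i)) (by omega)
    rw [hA, dist_smul, dist_pow_smul g x₀ (by omega)] at h1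
    rw [cA] at h2
    linarith
  have dQZ : dist Z x₀ ≤ (N - j) * τ + B + dist (γ • g ^ N • x₀) x₀ := by
    have h1 := dist_triangle Z (γ • g ^ N • x₀) x₀
    have h2 := hup (N - j) (by omega)
    rw [hZ, dist_smul, dist_pow_smul g x₀ (by omega)] at h1
    rw [cN] at h2
    linarith
  have dQgZ : dist (g ^ i • Z) x₀ ≤ dist Z x₀ + (i * τ + B) := by
    have h1 := dist_triangle (g ^ i • Z) (g ^ i • x₀) x₀
    have h2 := hup i hiK
    rw [dist_smul, dist_comm (g ^ i • x₀)] at h1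
    linarith
  have dPQ : dist P x₀ ≤ K * τ + B := by rw [dist_comm]; exact hup K le_rfl
  have dPQ' : K * τ ≤ dist P x₀ := by rw [dist_comm]; exact hlow K
  have dPP' : dist P' P ≤ i * τ + B := by
    rw [hP, hP', dist_pow_smul g x₀ (Nat.sub_le _ _), Nat.sub_sub_self hiK]
    exact hup i hiK
  have dP'Q : dist P' x₀ ≤ (K - i) * τ + B := by
    rw [dist_comm, ← cK]; exact hup _ (Nat.sub_le _ _)
  have dPgZ : dist P (g ^ i • Z) = dist P' Z := by
    rw [hP, hP']
    conv_lhs => rw [← Nat.add_sub_cancel' hiK, pow_add, mul_smul]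
    rw [dist_smul]
  have hL := hlow N
  have hs := dist_nonneg (x := P) (y := γ • x₀)
  have hijτ : (i : ℝ) * τ ≤ j * τ := by gcongr
  have dP'Z : dist P' Z ≤ dist P (γ • x₀) + (j - i) * τ + 3 * B + M + κ := by
    have h4 := h P' Z P x₀
    rw [dist_comm Z P] at h4
    rcases le_max_iff.1 (sub_le_iff_le_add.2 h4) with h5 | h5 <;> linarith
  -- Both points lie near a geodesic from `P` to `x₀`, at almost the same place.
  have h4 := h A (g ^ i • Z) P x₀
  rw [dist_comm (g ^ i • Z) P, dPgZ, dist_comm A P] at h4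
  rcases le_max_iff.1 (sub_le_iff_le_add.2 h4) with h5 | h5 <;> linarith

/-- With `u i = γ * g ^ i * γ⁻¹ * g ^ i` one has `u (i + k) = γ * g ^ i * γ⁻¹ * u k * g ^ i`, so `u
i = u (i + k)` forces `u k = 1`: `γ` conjugates `g ^ k` to its inverse. -/
theorem isAchiral_of_reversed {N : ℕ} {A : Set Γ} (hA : A.encard ≤ N) {g γ : Γ}
    (hmem : ∀ i ≤ N, γ * g ^ i * γ⁻¹ * g ^ i ∈ A) : IsAchiral g := by
  obtain ⟨i, j, hij, -, he⟩ := exists_eq_of_encard_le hA _ hmem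
  refine ⟨j - i, by omega, isConj_iff.2 ⟨γ, ?_⟩⟩
  obtain ⟨k, rfl⟩ := Nat.exists_eq_add_of_le hij.le
  rw [Nat.add_sub_cancel_left, zpow_neg, zpow_natCast, eq_inv_iff_mul_eq_one]
  simp only [pow_add] at he
  have h2 : g ^ i * g ^ k = g ^ k * g ^ i := by rw [← pow_add, ← pow_add, add_comm]
  have h3 : γ * (g ^ i * g ^ k) * γ⁻¹ * (g ^ i * g ^ k) =
      γ * g ^ i * γ⁻¹ * (γ * g ^ k * γ⁻¹ * g ^ k) * g ^ i := by
    conv_lhs => rw [show γ * (g ^ i * g ^ k) * γ⁻¹ * (g ^ i * g ^ k) =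
      γ * (g ^ i * g ^ k) * γ⁻¹ * (g ^ k * g ^ i) by rw [← h2]]
    group
  rw [h3, mul_assoc (γ * g ^ i * γ⁻¹) _ (g ^ i)] at he
  exact (mul_eq_right.1 (mul_left_cancel he).symm)

/-- Stable commutator length of chiral loxodromic elements is bounded away from zero. -/
theorem exists_scl_gap {δ : ℝ} (hδ : 0 < δ) (hS : IsHyperbolicSpace S δ)
    (hΓ : IsAcylindrical Γ S) :
    ∃ Θ : ℝ, 0 < Θ ∧ ∀ g : Γ, IsLoxodromic S g → IsChiral g → ENNReal.ofReal Θ ≤ scl g := by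
  have h := hS.fourPoint hδ
  have hgeo := hS.hasGeodesics
  set κ := 10 * δ with hκdef
  have hκ : 0 < κ := by positivity
  obtain ⟨τ₀, hτ₀, hgap⟩ := hΓ.exists_translationLength_ge h hκ hgeo
  set B := 8 * κ with hB
  have hB0 : 0 < B := by positivity
  -- The discount is `2 * B` because the length of `w` may exceed `N * τ` by `B`; each forward jump
  -- must still gain `B` over `N * τ`.
  obtain ⟨C₀, hC₀⟩ := h.exists_routeDist_add_le (Γ := Γ) (Δ := 2 * B) hκ hgeo (by positivity)
  set C := max C₀ 1 with hC
  have hC1 : 1 ≤ C := le_max_right _ _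
  set M := κ + 2 * (2 * C + 1) with hM
  obtain ⟨R, N₁, hR, hN₁, hRN⟩ := hΓ (2 * (2 * M) + 4 * B + 2 * κ) (by positivity)
  obtain ⟨N₂, hN₂⟩ := exists_nat_gt ((R + 4 * B) / τ₀)
  rw [div_lt_iff₀ hτ₀] at hN₂
  -- `N₁` provides more powers than acylindricity allows, and `N₂` puts the test points `γ • g ^ N₁
  -- • x₀` and `γ • g ^ N • x₀` at distance at least `R`.
  set N := N₁ + N₂ with hN
  have hN0 : 0 < N := by omega
  refine ⟨B / (8 * (3 * C) * N), by positivity, fun g hg hch => ?_⟩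
  refine ofReal_le_scl (F := 3 * C + 1) hN0 (by positivity) fun n hn hmem => ?_
  obtain ⟨x, -⟩ := id hg
  set τ := translationLength g x with hτ
  have hτ' : ∀ y : S, translationLength g y = τ := fun y => translationLength_eq g y x
  have hττ : τ₀ ≤ τ := hgap g hg x
  have hτ0 : 0 < τ := hτ₀.trans_le hττ
  have hn1 : (1 : ℝ) ≤ n := by exact_mod_cast hn
  have hN₂τ : R + 4 * B < N₂ * τ := hN₂.trans_le (by gcongr)
  have hNτ : R + 4 * B < N * τ := by
    have : (0 : ℝ) ≤ N₁ * τ := by positivity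
    rw [hN]; push_cast; linarith
  set K := N * n with hK
  have hNK : N ≤ K := Nat.le_mul_of_pos_right N hn
  have hKτ : N * τ ≤ K * τ := by gcongr
  -- The base point, and with it the quasi-morphism, depends on `n`. This is harmless since the
  -- defect `3 * C` does not.
  obtain ⟨x₀, hx₀⟩ := h.exists_axis_point hκ hgeo hτ' x (K := K) (by linarith)
  have hlow : ∀ j : ℕ, j * τ ≤ dist x₀ (g ^ j • x₀) := fun j => by
    rw [← hτ' x₀]; exact mul_translationLength_le_dist g x₀ j
  set w := g ^ N with hw
  have hL : 2 * (2 * B) ≤ dist x₀ (w • x₀) := by linarith [hlow N]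
  have hCw : ∀ x y p : S, excess x y p ≤ κ → routeDist x₀ w (2 * B) x p +
      routeDist x₀ w (2 * B) p y ≤ routeDist x₀ w (2 * B) x y + C := fun x y p hp =>
    (hC₀ x₀ w hL x y p hp).trans (add_le_add_right (le_max_left _ _) _)
  have hwn : w ^ n = g ^ K := by rw [hw, hK, pow_mul]
  have hbound := abs_le_wordNorm (φ := fun a => routeDist x₀ w (2 * B) x₀ (a • x₀) -
    routeDist x₀ w (2 * B) (a • x₀) x₀) (abs_routeDist_sub_le hL h hκ hgeo hCw) hmem
  have hforward : ∀ k : ℕ, Route x₀ w (2 * B) x₀ (w ^ k • x₀)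
      (k * (dist x₀ (w • x₀) - 2 * B)) := by
    intro k
    induction k with
    | zero => simpa using Route.nil
    | succ k ih =>
      have := ih.jump (w ^ k)
      rw [← mul_smul, ← pow_succ] at this
      exact this.congr (by push_cast; ring)
  have hfor := routeDist_le hL (hforward n)
  have hback : dist (w ^ n • x₀) x₀ ≤ routeDist x₀ w (2 * B) (w ^ n • x₀) x₀ + 1 := by
    obtain ⟨c, hc, hc'⟩ := exists_route_lt (x₀ := x₀) (w := w) (Δ := 2 * B) (w ^ n • x₀) x₀ one_pos
    rcases hc.dist_le_or with hcd | ⟨γ, c₁, c₂, r₁, r₂, hce⟩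
    · linarith
    exfalso
    have k1 := routeDist_le hL r₁
    have k2 := routeDist_le hL r₂
    have k3 := routeDist_le hL (route_jump (x₀ := x₀) (w := w) (Δ := 2 * B) γ)
    have k4 := routeDist_triangle hL (w ^ n • x₀) (γ • x₀) (γ • w • x₀)
    have k5 := routeDist_triangle hL (w ^ n • x₀) (γ • w • x₀) x₀
    -- Near-optimality within `1` puts both ends of the jump close to the geodesic from `w ^ n • x₀`
    -- to `x₀`, in this order. The two errors `M` add up to the `2 * M` below.
    have e1 := excess_le_of_routeDist_add_le (E := 1) hL h hκ hgeo hCw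
      (x := w ^ n • x₀) (q := γ • w • x₀) (y := x₀) (by linarith)
    have e2 := excess_le_of_routeDist_add_le (E := 1) hL h hκ hgeo hCw
      (x := w ^ n • x₀) (q := γ • x₀) (y := γ • w • x₀) (by linarith)
    unfold excess at e1 e2
    rw [dist_smul] at e2
    have hrev := fun i j hij hj => h.dist_smul_le_of_reversed (γ := γ) (M := 2 * M) hκ hNK hτ0.le
      hB0.le (by positivity) hlow hx₀ (by rw [← hw, ← hwn]; linarith) (i := i) (j := j) hij hj
    refine hch (isAchiral_of_reversed (γ := γ) (hRN (γ • g ^ N₁ • x₀) (γ • g ^ N • x₀) ?_)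
      fun i hi => ⟨hrev i N₁ hi (by omega), hrev i N (by omega) le_rfl⟩)
    rw [dist_smul, dist_pow_smul g x₀ (by omega), hN, Nat.add_sub_cancel_left]
    linarith [hlow N₂]
  have hfar : K * τ ≤ dist (w ^ n • x₀) x₀ := by rw [hwn, dist_comm]; exact hlow K
  have hLup := hx₀ N hNK
  have hKe : (K : ℝ) * τ = n * (N * τ) := by rw [hK]; push_cast; ring
  have hmul : (n : ℝ) * (dist x₀ (w • x₀) - 2 * B) ≤ n * (N * τ - B) :=
    mul_le_mul_of_nonneg_left (by linarith) (by positivity)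
  have := (abs_le.1 hbound).1
  linarith

end Gap

end SclGap

theorem mainTheorem6 {Γ S : Type*} [Group Γ] [MetricSpace S] [MulAction Γ S]
    [IsIsometricSMul Γ S] (δ : ℝ) (hδ : 0 < δ) (hS : SclGap.IsHyperbolicSpace S δ)
    (hΓ : SclGap.IsAcylindrical Γ S) :
    (∀ g : Γ, SclGap.IsLoxodromic S g → (SclGap.IsAchiral g ↔ SclGap.scl g = 0)) ∧
    ∃ Θ : ℝ, 0 < Θ ∧
      ∀ g : Γ, SclGap.IsLoxodromic S g → SclGap.IsChiral g →
        ENNReal.ofReal Θ ≤ SclGap.scl g := by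
  obtain ⟨Θ, hΘ, hgap⟩ := SclGap.exists_scl_gap hδ hS hΓ
  refine ⟨fun g hg => ⟨SclGap.scl_eq_zero_of_isAchiral, fun hzero => ?_⟩, Θ, hΘ, hgap⟩
  by_contra hch
  have h := hgap g hg hch
  rw [hzero, nonpos_iff_eq_zero, ENNReal.ofReal_eq_zero] at h
  linarith
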